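/- **Theorem (Type Preservation).** Fix a signature of contractive, mutually recursive type definitions $X = A$ ($A$ not itself a type name) and of process definitions $\Omega_f \vdash f = P_f :: (x : A_f)$, and assume that every process definition is well typed, i.e. $\Omega_f \vdash P_f :: (x : A_f)$. If $\Omega' \vDash \mathcal{C} :: \Omega$ and $\mathcal{C} \mapsto \mathcal{D}$, then $\Omega' \vDash \mathcal{D} :: \Omega$. The notions are as follows. *Types.* $A, B ::= X \mid {\oplus}\{\ell{:}A_\ell\}_{\ell\in L} \mid {\&}\{\ell{:}A_\ell\}_{\ell\in L} \mid \mathbf 1 \mid A\otimes B \mid A\multimap B \mid \bigcirc A \mid \Box A \mid \Diamond A$, with $L$ a finite set of labels; types are equi-recursive, i.e. identified when their complete unfoldings coincide. The partial operations $[\cdot]_L^{-t}$, $[\cdot]_R^{-t}$ ($t\in\mathbb N$) are given by $[\bigcirc A]_L^{-1}=[\bigcirc A]_R^{-1}=A$, $[\Box A]_L^{-1}=\Box A$, $[\Diamond A]_R^{-1}=\Diamond A$, undefined in all other cases, and $[A]^{-0}=A$, $[A]^{-(t+1)}=[[A]^{-t}]^{-1}$ on either side. We write $A\ \mathsf{delayed}^\Box$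 if $A=\bigcirc^n\Box A'$, and $A\ \mathsf{delayed}^\Diamond$ if $A=\bigcirc^n\Diamond A'$, for some $n\ge 0$ and $A'$. Weak subtyping $<:$ is given by $\bigcirc^m\Box A<:\bigcirc^n\Box A$ for $m\le n$, $\bigcirc^m\Diamond A<:\bigcirc^n\Diamond A$ for $m\ge n$, and $A<:A$. Contexts $\Omega$ are finite collections of declarations $x{:}A$, up to order; all notions extend to them pointwise. *Processes and their typing.* Processes are considered up to renaming of bound channels; all channels declared in a sequent $\Omega\vdash P::(z:C)$ are distinct. The rules are (premises $\Rightarrow$ conclusion): - $\Omega'\vdash P::(x:A)$, $\ \Omega,x{:}A\vdash Q::(z:C)$ $\Rightarrow$ $\Omega,\Omega'\vdash (x{:}A\leftarrow P;Q)::(z:C)$; - $\Omega,x{:}A_f\vdash Q::(z:C)$ $\Rightarrow$ $\Omega,\overline e{:}\Omega_f\vdash (x\leftarrow f\leftarrow\overline e;Q)::(z:C)$; - $y{:}A\vdash (x\leftarrow y)::(x:A)$; - $\Omega\vdash P::(x:A_k)$, $k\in L$ $\Rightarrow$ $\Omega\vdash(x.k;P)::(x:{\oplus}\{\ell{:}A_\ell\}_{\ell\in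 L})$; - $\Omega,x{:}A_\ell\vdash Q_\ell::(z:C)$ for all $\ell\in L$ $\Rightarrow$ $\Omega,x{:}{\oplus}\{\ell{:}A_\ell\}_{\ell\in L}\vdash \mathsf{case}\,x\,(\ell\Rightarrow Q_\ell)_{\ell\in L}::(z:C)$; - $\Omega\vdash P_\ell::(x:A_\ell)$ for all $\ell\in L$ $\Rightarrow$ $\Omega\vdash\mathsf{case}\,x\,(\ell\Rightarrow P_\ell)_{\ell\in L}::(x:{\&}\{\ell{:}A_\ell\}_{\ell\in L})$; - $\Omega,x{:}A_k\vdash Q::(z:C)$, $k\in L$ $\Rightarrow$ $\Omega,x{:}{\&}\{\ell{:}A_\ell\}_{\ell\in L}\vdash(x.k;Q)::(z:C)$; - $\cdot\vdash\mathsf{close}\,x::(x:\mathbf 1)$; and $\Omega\vdash Q::(z:C)$ $\Rightarrow$ $\Omega,x{:}\mathbf 1\vdash(\mathsf{wait}\,x;Q)::(z:C)$; - $\Omega\vdash P::(x:B)$ $\Rightarrow$ $\Omega,y{:}A\vdash(\mathsf{send}\,x\,y;P)::(x:A\otimes B)$; - $\Omega,y{:}A,x{:}B\vdash Q::(z:C)$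 $\Rightarrow$ $\Omega,x{:}A\otimes B\vdash(y\leftarrow\mathsf{recv}\,x;Q)::(z:C)$; - $\Omega,y{:}A\vdash P::(x:B)$ $\Rightarrow$ $\Omega\vdash(y\leftarrow\mathsf{recv}\,x;P)::(x:A\multimap B)$; - $\Omega,x{:}B\vdash Q::(z:C)$ $\Rightarrow$ $\Omega,x{:}A\multimap B,y{:}A\vdash(\mathsf{send}\,x\,y;Q)::(z:C)$; - $[\Omega]_L^{-1}\vdash P::(x:[A]_R^{-1})$ with both shifts defined $\Rightarrow$ $\Omega\vdash(\mathsf{delay};P)::(x:A)$; - $\Omega\vdash P::(x:A)$ $\Rightarrow$ $\Omega\vdash(\mathsf{now!}\,x;P)::(x:\Diamond A)$; and $\Omega,x{:}A\vdash Q::(z:C)$ $\Rightarrow$ $\Omega,x{:}\Box A\vdash(\mathsf{now!}\,x;Q)::(z:C)$; - $\Omega\ \mathsf{delayed}^\Box$, $\Omega,x{:}A\vdash Q::(z:C)$, $C\ \mathsf{delayed}^\Diamond$ $\Rightarrow$ $\Omega,x{:}\Diamond A\vdash(\mathsf{when?}\,x;Q)::(z:C)$; - $\Omega\ \mathsf{delayed}^\Box$,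 $\Omega\vdash P::(x:A)$ $\Rightarrow$ $\Omega\vdash(\mathsf{when?}\,x;P)::(x:\Box A)$. *Configurations.* A configuration is a finite multiset of objects $\mathsf{proc}(c,t,P)$ and $\mathsf{msg}(c,t,M)$, each providing the channel $c$ at time $t\in\mathbb N$, where a message $M$ is a process of one of the forms $(c.k;c\leftarrow c')$, $(c.k;c'\leftarrow c)$, $\mathsf{close}\,c$, $(\mathsf{send}\,c\,d;c\leftarrow c')$, $(\mathsf{send}\,c\,d;c'\leftarrow c)$, $(\mathsf{now!}\,c;c\leftarrow c')$, $(\mathsf{now!}\,c;c'\leftarrow c)$. The judgment $\Omega'\vDash\mathcal C::\Omega$ presupposes that the channels declared in $\Omega'$ and those provided by the objects of $\mathcal C$ are all distinct, and is derived by the rules: $\Omega\vDash(\cdot)::\Omega$; if $\Omega_0\vDash\mathcal C_1::\Omega_1$ and $\Omega_1\vDash\mathcal C_2::\Omega_2$ then $\Omega_0\vDash(\mathcal C_1\,\mathcal C_2)::\Omega_2$; and if $\Omega'<:\Omega$, $[\Omega]_L^{-t}\vdash P::(c:[A]_R^{-t})$ (all shifts defined) and $A<:A'$, then $\Omega_0,\Omega'\vDash\mathsf{proc}(c,t,P)::(\Omega_0,c{:}A')$,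 and likewise for $\mathsf{msg}(c,t,M)$ with $M$ in place of $P$. *Steps.* $\mathcal C\mapsto\mathcal D$ holds if $\mathcal D$ arises from $\mathcal C$ by replacing a sub-multiset according to one of the following rules, where fresh channels ($a$ in the first two rules, $c'$ in the sending rules marked $*$) occur neither in $\mathcal C$ nor in $\Omega'$: - $\mathsf{proc}(c,t,x{:}A\leftarrow P;Q)\mapsto\mathsf{proc}(a,t,[a/x]P),\mathsf{proc}(c,t,[a/x]Q)$; - $\mathsf{proc}(c,t,x\leftarrow f\leftarrow\overline e;Q)\mapsto\mathsf{proc}(a,t,[a/x,\overline e/\Omega_f]P_f),\mathsf{proc}(c,t,[a/x]Q)$; - $\mathsf{msg}(d,t,M),\mathsf{proc}(c,s,c\leftarrow d)\mapsto\mathsf{msg}(c,t,[c/d]M)$ if $s\le t$; - $\mathsf{proc}(c,s,c\leftarrow d),\mathsf{msg}(e,t,M)\mapsto\mathsf{msg}(e,t,[d/c]M)$ if $c$ occurs in $M$ and $s\le t$; - $*$ for a send prefix $\pi$ among $c.k$, $\mathsf{send}\,c\,d$, $\mathsf{now!}\,c$: $\ \mathsf{proc}(c,t,\pi;P)\mapsto\mathsf{proc}(c',t,[c'/c]P),\mathsf{msg}(c,t,\pi;c\leftarrow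 c')$, and, for $e\ne c$, $\ \mathsf{proc}(e,t,\pi;Q)\mapsto\mathsf{msg}(c',t,\pi;c'\leftarrow c),\mathsf{proc}(e,t,[c'/c]Q)$; - $\mathsf{msg}(c,t,c.k;c\leftarrow c'),\mathsf{proc}(d,t,\mathsf{case}\,c\,(\ell\Rightarrow Q_\ell)_{\ell\in L})\mapsto\mathsf{proc}(d,t,[c'/c]Q_k)$ and $\mathsf{proc}(c,t,\mathsf{case}\,c\,(\ell\Rightarrow Q_\ell)_{\ell\in L}),\mathsf{msg}(c',t,c.k;c'\leftarrow c)\mapsto\mathsf{proc}(c',t,[c'/c]Q_k)$, for $k\in L$; - $\mathsf{proc}(c,t,\mathsf{close}\,c)\mapsto\mathsf{msg}(c,t,\mathsf{close}\,c)$ and $\mathsf{msg}(c,t,\mathsf{close}\,c),\mathsf{proc}(d,t,\mathsf{wait}\,c;Q)\mapsto\mathsf{proc}(d,t,Q)$; - $\mathsf{msg}(c,t,\mathsf{send}\,c\,d;c\leftarrow c'),\mathsf{proc}(e,t,x\leftarrow\mathsf{recv}\,c;Q)\mapsto\mathsf{proc}(e,t,[c',d/c,x]Q)$ and $\mathsf{proc}(c,t,x\leftarrow\mathsf{recv}\,c;P),\mathsf{msg}(c',t,\mathsf{send}\,c\,d;c'\leftarrow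 c)\mapsto\mathsf{proc}(c',t,[c',d/c,x]P)$; - $\mathsf{proc}(c,t,\mathsf{delay};P)\mapsto\mathsf{proc}(c,t+1,P)$; - $\mathsf{msg}(c,t,\mathsf{now!}\,c;c\leftarrow c'),\mathsf{proc}(d,s,\mathsf{when?}\,c;Q)\mapsto\mathsf{proc}(d,t,[c'/c]Q)$ and $\mathsf{proc}(c,s,\mathsf{when?}\,c;P),\mathsf{msg}(c',t,\mathsf{now!}\,c;c'\leftarrow c)\mapsto\mathsf{proc}(c',t,[c'/c]P)$, if $s\le t$. -/

import Mathlib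

namespace TemporalSession

/-! ## Session types

Type expressions are finite, may mention defined type names, and are read equi-recursively: two
expressions denote the same type iff their complete (possibly infinite) unfoldings coincide. -/

/-- Type expressions over the type names `TName` and the choice labels `Label`. -/
inductive TyExp (TName Label : Type) : Type
  | name (X : TName) : TyExp TName Label
  /-- internal choice `⊕{ℓ : A_ℓ}_{ℓ ∈ L}` -/
  | plus (L : Finset Label) (A : {l // l ∈ L} → TyExp TName Label) : TyExp TName Label
  /-- external choice `&{ℓ : A_ℓ}_{ℓ ∈ L}` -/
  | amp (L : Finset Label) (A : {l // l ∈ L} → TyExp TName Label) : TyExp TName Label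
  | one : TyExp TName Label
  | tensor (A B : TyExp TName Label) : TyExp TName Label
  | lolli (A B : TyExp TName Label) : TyExp TName Label
  /-- `◯ A` -/
  | next (A : TyExp TName Label) : TyExp TName Label
  /-- `□ A` -/
  | box (A : TyExp TName Label) : TyExp TName Label
  /-- `◇ A` -/
  | dia (A : TyExp TName Label) : TyExp TName Label

/-- Mutually recursive type definitions `X = A`, where `A` is contractive: it is not a type name. -/
structure TypeDefs (TName Label : Type) where
  body : TName → TyExp TName Label
  contractive : ∀ X Y, body X ≠ .name Y

/-- Both arguments have the same outermost type constructor (and the same label set), and their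
immediate components are pairwise related by `R`. -/
inductive SameHead {TName Label : Type} (R : TyExp TName Label → TyExp TName Label → Prop) :
    TyExp TName Label → TyExp TName Label → Prop
  | plus (L : Finset Label) (A B : {l // l ∈ L} → TyExp TName Label) :
      (∀ l, R (A l) (B l)) → SameHead R (.plus L A) (.plus L B)
  | amp (L : Finset Label) (A B : {l // l ∈ L} → TyExp TName Label) :
      (∀ l, R (A l) (B l)) → SameHead R (.amp L A) (.amp L B)
  | one : SameHead R .one .one
  | tensor (A A' B B' : TyExp TName Label) :
      R A A' → R B B' → SameHead R (.tensor A B) (.tensor A' B')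
  | lolli (A A' B B' : TyExp TName Label) :
      R A A' → R B B' → SameHead R (.lolli A B) (.lolli A' B')
  | next (A A' : TyExp TName Label) : R A A' → SameHead R (.next A) (.next A')
  | box (A A' : TyExp TName Label) : R A A' → SameHead R (.box A) (.box A')
  | dia (A A' : TyExp TName Label) : R A A' → SameHead R (.dia A) (.dia A')

namespace TypeDefs

variable {TName Label : Type} (S : TypeDefs TName Label)

/-- Replace a type name in head position by its definition. -/
def unfold : TyExp TName Label → TyExp TName Label
  | .name X => S.body X
  | A => A

/-- Equi-recursive equality: the largest relation compatible with unfolding of definitions. -/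
def TyEq (A B : TyExp TName Label) : Prop :=
  ∃ R : TyExp TName Label → TyExp TName Label → Prop,
    R A B ∧ ∀ A' B', R A' B' → SameHead R (S.unfold A') (S.unfold B')

theorem unfold_ne_name (A : TyExp TName Label) (Y : TName) : S.unfold A ≠ .name Y := by
  cases A <;> simp [unfold, S.contractive]

theorem tyEq_refl (A : TyExp TName Label) : S.TyEq A A := by
  refine ⟨Eq, rfl, ?_⟩
  rintro A' _ rfl
  have h := S.unfold_ne_name A'
  generalize S.unfold A' = B at h
  cases B with
  | name X => exact absurd rfl (h X)
  | _ => constructor <;> intros <;> rfl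

theorem tyEq_symm {A B : TyExp TName Label} (h : S.TyEq A B) : S.TyEq B A := by
  obtain ⟨R, hR, hs⟩ := h
  refine ⟨fun X Y => R Y X, hR, fun A' B' h' => ?_⟩
  have h2 := hs _ _ h'
  generalize S.unfold A' = C at h2
  generalize S.unfold B' = D at h2
  cases h2 <;> constructor <;> assumption

theorem tyEq_trans {A B C : TyExp TName Label} (h : S.TyEq A B) (h' : S.TyEq B C) :
    S.TyEq A C := by
  obtain ⟨R, hR, hs⟩ := h
  obtain ⟨R', hR', hs'⟩ := h'
  refine ⟨fun X Z => ∃ Y, R X Y ∧ R' Y Z, ⟨_, hR, hR'⟩, ?_⟩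
  rintro A' C' ⟨B', h1, h2⟩
  have k1 := hs _ _ h1
  have k2 := hs' _ _ h2
  generalize S.unfold A' = X at k1
  generalize S.unfold B' = Y at k1 k2
  generalize S.unfold C' = Z at k2
  cases k1 <;> cases k2 <;> constructor <;>
    first
    | exact ⟨_, by assumption, by assumption⟩
    | (intro l; exact ⟨_, by solve_by_elim, by solve_by_elim⟩)

/-- Equi-recursive equality as a setoid. -/
def setoid : Setoid (TyExp TName Label) where
  r := S.TyEq
  iseqv := ⟨S.tyEq_refl, S.tyEq_symm, S.tyEq_trans⟩

end TypeDefs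

/-- Session types: type expressions modulo silent unfolding of the type definitions `S`. -/
def Ty {TName Label : Type} (S : TypeDefs TName Label) : Type := Quotient S.setoid

namespace Ty

variable {TName Label : Type} {S : TypeDefs TName Label}

/-- The type denoted by a type expression. -/
def mk (A : TyExp TName Label) : Ty S := Quotient.mk S.setoid A

/-- A chosen type expression denoting the given type. -/
noncomputable def rep (A : Ty S) : TyExp TName Label := Quotient.out A

noncomputable def plus (L : Finset Label) (A : {l // l ∈ L} → Ty S) : Ty S :=
  mk (.plus L fun l => (A l).rep)

noncomputable def amp (L : Finset Label) (A : {l // l ∈ L} → Ty S) : Ty S :=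
  mk (.amp L fun l => (A l).rep)

def one : Ty S := mk .one

noncomputable def tensor (A B : Ty S) : Ty S := mk (.tensor A.rep B.rep)

noncomputable def lolli (A B : Ty S) : Ty S := mk (.lolli A.rep B.rep)

noncomputable def next (A : Ty S) : Ty S := mk (.next A.rep)

noncomputable def box (A : Ty S) : Ty S := mk (.box A.rep)

noncomputable def dia (A : Ty S) : Ty S := mk (.dia A.rep)

/-- A defined type name and its definition denote the same type. -/
theorem mk_name (X : TName) : (mk (.name X) : Ty S) = mk (S.body X) := by
  refine Quotient.sound (s := S.setoid) ⟨fun A B => S.unfold A = S.unfold B, ?_, ?_⟩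
  · have h : S.unfold (S.body X) = S.body X := by
      have h := S.contractive X
      generalize S.body X = B at h
      cases B with
      | name Y => exact absurd rfl (h Y)
      | _ => rfl
    exact h.symm
  · intro A B h
    rw [h]
    have h' := S.unfold_ne_name B
    generalize S.unfold B = D at h'
    cases D with
    | name Y => exact absurd rfl (h' Y)
    | _ => constructor <;> intros <;> rfl

/-- `◯ⁿ A` -/
noncomputable def nextN (n : ℕ) (A : Ty S) : Ty S := next^[n] A

/-! ### Time shifts

`[A]_L^{-t}` and `[A]_R^{-t}` are partial functions; they are given by their graphs. -/

/-- `ShiftL1 A B`: `[A]_L^{-1}` is defined and equal to `B`. -/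
inductive ShiftL1 : Ty S → Ty S → Prop
  | next (A : Ty S) : ShiftL1 (next A) A
  | box (A : Ty S) : ShiftL1 (box A) (box A)

/-- `ShiftR1 A B`: `[A]_R^{-1}` is defined and equal to `B`. -/
inductive ShiftR1 : Ty S → Ty S → Prop
  | next (A : Ty S) : ShiftR1 (next A) A
  | dia (A : Ty S) : ShiftR1 (dia A) (dia A)

/-- `ShiftL t A B`: `[A]_L^{-t}` is defined and equal to `B`. -/
inductive ShiftL : ℕ → Ty S → Ty S → Prop
  | zero (A : Ty S) : ShiftL 0 A A
  | succ (t : ℕ) (A B C : Ty S) : ShiftL t A B → ShiftL1 B C → ShiftL (t + 1) A C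

/-- `ShiftR t A B`: `[A]_R^{-t}` is defined and equal to `B`. -/
inductive ShiftR : ℕ → Ty S → Ty S → Prop
  | zero (A : Ty S) : ShiftR 0 A A
  | succ (t : ℕ) (A B C : Ty S) : ShiftR t A B → ShiftR1 B C → ShiftR (t + 1) A C

/-- `A delayed^□` -/
def DelayedBox (A : Ty S) : Prop := ∃ n B, A = nextN n (box B)

/-- `A delayed^◇` -/
def DelayedDia (A : Ty S) : Prop := ∃ n B, A = nextN n (dia B)

/-- Weak subtyping `A <: B`. -/
inductive WeakSub : Ty S → Ty S → Prop
  | box (m n : ℕ) (A : Ty S) : m ≤ n → WeakSub (nextN m (box A)) (nextN n (box A))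
  | dia (m n : ℕ) (A : Ty S) : n ≤ m → WeakSub (nextN m (dia A)) (nextN n (dia A))
  | refl (A : Ty S) : WeakSub A A

end Ty

/-! ## Process expressions -/

/-- Process expressions with free channel variables in `V`. A construct that binds a channel
variable has a continuation over `Option V`, where `none` is the bound variable; so expressions
are identified up to renaming of bound variables. `arity f` is the number of channels that the
defined process `f` uses. -/
inductive Proc {TName Label PName : Type} (S : TypeDefs TName Label) (arity : PName → ℕ) :
    Type → Type 1
  /-- `x ← f ← es ; Q` -/
  | call {V : Type} (f : PName) (es : Fin (arity f) → V) (Q : Proc S arity (Option V)) :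
      Proc S arity V
  /-- `x:A ← P ; Q` -/
  | cut {V : Type} (A : Ty S) (P Q : Proc S arity (Option V)) : Proc S arity V
  /-- `c ← d` -/
  | fwd {V : Type} (c d : V) : Proc S arity V
  /-- `c.k ; P` -/
  | sel {V : Type} (c : V) (k : Label) (P : Proc S arity V) : Proc S arity V
  /-- `case c (ℓ ⇒ P_ℓ)_{ℓ ∈ L}` -/
  | case {V : Type} (c : V) (L : Finset Label) (P : {l // l ∈ L} → Proc S arity V) :
      Proc S arity V
  /-- `close c` -/
  | close {V : Type} (c : V) : Proc S arity V
  /-- `wait c ; P` -/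
  | wait {V : Type} (c : V) (P : Proc S arity V) : Proc S arity V
  /-- `send c d ; P` -/
  | send {V : Type} (c d : V) (P : Proc S arity V) : Proc S arity V
  /-- `x ← recv c ; P` -/
  | recv {V : Type} (c : V) (P : Proc S arity (Option V)) : Proc S arity V
  /-- `delay ; P` (also written `tick ; P`) -/
  | delay {V : Type} (P : Proc S arity V) : Proc S arity V
  /-- `now! c ; P` -/
  | now {V : Type} (c : V) (P : Proc S arity V) : Proc S arity V
  /-- `when? c ; P` -/
  | when {V : Type} (c : V) (P : Proc S arity V) : Proc S arity V

namespace Proc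

variable {TName Label PName : Type} {S : TypeDefs TName Label} {arity : PName → ℕ}

/-- Simultaneous substitution of channels for the free channel variables. -/
def rename : {V : Type} → Proc S arity V → {W : Type} → (V → W) → Proc S arity W
  | _, .call f es Q, _, r => .call f (fun i => r (es i)) (Q.rename (Option.map r))
  | _, .cut A P Q, _, r => .cut A (P.rename (Option.map r)) (Q.rename (Option.map r))
  | _, .fwd c d, _, r => .fwd (r c) (r d)
  | _, .sel c k P, _, r => .sel (r c) k (P.rename r)
  | _, .case c L P, _, r => .case (r c) L (fun l => (P l).rename r)
  | _, .close c, _, r => .close (r c)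
  | _, .wait c P, _, r => .wait (r c) (P.rename r)
  | _, .send c d P, _, r => .send (r c) (r d) (P.rename r)
  | _, .recv c P, _, r => .recv (r c) (P.rename (Option.map r))
  | _, .delay P, _, r => .delay (P.rename r)
  | _, .now c P, _, r => .now (r c) (P.rename r)
  | _, .when c P, _, r => .when (r c) (P.rename r)

/-- The channels that occur free. -/
def free : {V : Type} → Proc S arity V → Set V
  | _, .call _ es Q => {v | (∃ i, es i = v) ∨ some v ∈ Q.free}
  | _, .cut _ P Q => {v | some v ∈ P.free ∨ some v ∈ Q.free}
  | _, .fwd c d => {c, d}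
  | _, .sel c _ P => {v | v = c ∨ v ∈ P.free}
  | _, .case c _ P => {v | v = c ∨ ∃ l, v ∈ (P l).free}
  | _, .close c => {c}
  | _, .wait c P => {v | v = c ∨ v ∈ P.free}
  | _, .send c d P => {v | v = c ∨ v = d ∨ v ∈ P.free}
  | _, .recv c P => {v | v = c ∨ some v ∈ P.free}
  | _, .delay P => P.free
  | _, .now c P => {v | v = c ∨ v ∈ P.free}
  | _, .when c P => {v | v = c ∨ v ∈ P.free}

end Proc

/-- The part of the global signature that defines processes: for every name `f` a definition
`Ω_f ⊢ f = P_f :: (x : A_f)`. In `P_f` the variable `none` stands for `x`, and `some i` for the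
`i`-th channel of `Ω_f`. -/
structure ProcDefs {TName Label : Type} (S : TypeDefs TName Label) (PName : Type) where
  arity : PName → ℕ
  params : (f : PName) → Fin (arity f) → Ty S
  result : PName → Ty S
  body : (f : PName) → Proc S arity (Option (Fin (arity f)))

/-! ## Process typing -/

/-- Contexts `x₁:A₁, …, xₙ:Aₙ`, up to order. -/
abbrev Ctx {TName Label : Type} (S : TypeDefs TName Label) (V : Type) : Type :=
  Multiset (V × Ty S)

namespace Ctx

variable {TName Label : Type} {S : TypeDefs TName Label} {V : Type}

/-- The channels declared in a context. -/
def dom (Ω : Ctx S V) : Multiset V := Ω.map Prod.fst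

/-- The same context, seen below a binder. -/
def weaken (Ω : Ctx S V) : Ctx S (Option V) := Ω.map fun p => (some p.1, p.2)

/-- Pointwise extension to contexts of a relation between types. -/
def Lift (R : Ty S → Ty S → Prop) (Ω Ω' : Ctx S V) : Prop :=
  Multiset.Rel (fun p q => p.1 = q.1 ∧ R p.2 q.2) Ω Ω'

/-- `Ω delayed^□` -/
def DelayedBox (Ω : Ctx S V) : Prop := ∀ p ∈ Ω, Ty.DelayedBox p.2

/-- The context `e₁:A₁, …, eₙ:Aₙ`. -/
def ofFn {n : ℕ} (e : Fin n → V) (A : Fin n → Ty S) : Ctx S V :=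
  (Finset.univ : Finset (Fin n)).val.map fun i => (e i, A i)

end Ctx

/-- Derivability of `Ω ⊢ P :: (z : C)` by the typing rules (see `HasType`). -/
inductive Derives {TName Label PName : Type} {S : TypeDefs TName Label} (F : ProcDefs S PName) :
    {V : Type} → Ctx S V → Proc S F.arity V → V → Ty S → Prop
  | cut {V : Type} (Ω Ω' : Ctx S V) (A C : Ty S) (P Q : Proc S F.arity (Option V)) (z : V) :
      Derives F Ω'.weaken P none A →
      Derives F ((none, A) ::ₘ Ω.weaken) Q (some z) C →
      Derives F (Ω + Ω') (.cut A P Q) z C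
  | call {V : Type} (Ω : Ctx S V) (f : PName) (es : Fin (F.arity f) → V) (C : Ty S)
      (Q : Proc S F.arity (Option V)) (z : V) :
      Derives F ((none, F.result f) ::ₘ Ω.weaken) Q (some z) C →
      Derives F (Ω + Ctx.ofFn es (F.params f)) (.call f es Q) z C
  | id {V : Type} (x y : V) (A : Ty S) : Derives F {(y, A)} (.fwd x y) x A
  | plusR {V : Type} (Ω : Ctx S V) (x : V) (L : Finset Label) (A : {l // l ∈ L} → Ty S)
      (k : {l // l ∈ L}) (P : Proc S F.arity V) :
      Derives F Ω P x (A k) → Derives F Ω (.sel x k P) x (.plus L A)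
  | plusL {V : Type} (Ω : Ctx S V) (x : V) (L : Finset Label) (A : {l // l ∈ L} → Ty S)
      (Q : {l // l ∈ L} → Proc S F.arity V) (z : V) (C : Ty S) :
      (∀ l, Derives F ((x, A l) ::ₘ Ω) (Q l) z C) →
      Derives F ((x, .plus L A) ::ₘ Ω) (.case x L Q) z C
  | ampR {V : Type} (Ω : Ctx S V) (x : V) (L : Finset Label) (A : {l // l ∈ L} → Ty S)
      (P : {l // l ∈ L} → Proc S F.arity V) :
      (∀ l, Derives F Ω (P l) x (A l)) → Derives F Ω (.case x L P) x (.amp L A)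
  | ampL {V : Type} (Ω : Ctx S V) (x : V) (L : Finset Label) (A : {l // l ∈ L} → Ty S)
      (k : {l // l ∈ L}) (Q : Proc S F.arity V) (z : V) (C : Ty S) :
      Derives F ((x, A k) ::ₘ Ω) Q z C →
      Derives F ((x, .amp L A) ::ₘ Ω) (.sel x k Q) z C
  | oneR {V : Type} (x : V) : Derives F 0 (.close x) x .one
  | oneL {V : Type} (Ω : Ctx S V) (x : V) (Q : Proc S F.arity V) (z : V) (C : Ty S) :
      Derives F Ω Q z C → Derives F ((x, .one) ::ₘ Ω) (.wait x Q) z C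
  | tensorR {V : Type} (Ω : Ctx S V) (x y : V) (A B : Ty S) (P : Proc S F.arity V) :
      Derives F Ω P x B → Derives F ((y, A) ::ₘ Ω) (.send x y P) x (.tensor A B)
  | tensorL {V : Type} (Ω : Ctx S V) (x : V) (A B : Ty S) (Q : Proc S F.arity (Option V))
      (z : V) (C : Ty S) :
      Derives F ((none, A) ::ₘ (some x, B) ::ₘ Ω.weaken) Q (some z) C →
      Derives F ((x, .tensor A B) ::ₘ Ω) (.recv x Q) z C
  | lolliR {V : Type} (Ω : Ctx S V) (x : V) (A B : Ty S) (P : Proc S F.arity (Option V)) :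
      Derives F ((none, A) ::ₘ Ω.weaken) P (some x) B →
      Derives F Ω (.recv x P) x (.lolli A B)
  | lolliL {V : Type} (Ω : Ctx S V) (x y : V) (A B : Ty S) (Q : Proc S F.arity V)
      (z : V) (C : Ty S) :
      Derives F ((x, B) ::ₘ Ω) Q z C →
      Derives F ((x, .lolli A B) ::ₘ (y, A) ::ₘ Ω) (.send x y Q) z C
  | nextLR {V : Type} (Ω Ω₁ : Ctx S V) (x : V) (A A₁ : Ty S) (P : Proc S F.arity V) :
      Ctx.Lift Ty.ShiftL1 Ω Ω₁ → Ty.ShiftR1 A A₁ →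
      Derives F Ω₁ P x A₁ → Derives F Ω (.delay P) x A
  | diaR {V : Type} (Ω : Ctx S V) (x : V) (A : Ty S) (P : Proc S F.arity V) :
      Derives F Ω P x A → Derives F Ω (.now x P) x (.dia A)
  | diaL {V : Type} (Ω : Ctx S V) (x : V) (A : Ty S) (Q : Proc S F.arity V) (z : V) (C : Ty S) :
      Ctx.DelayedBox Ω → Derives F ((x, A) ::ₘ Ω) Q z C → Ty.DelayedDia C →
      Derives F ((x, .dia A) ::ₘ Ω) (.when x Q) z C
  | boxR {V : Type} (Ω : Ctx S V) (x : V) (A : Ty S) (P : Proc S F.arity V) :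
      Ctx.DelayedBox Ω → Derives F Ω P x A → Derives F Ω (.when x P) x (.box A)
  | boxL {V : Type} (Ω : Ctx S V) (x : V) (A : Ty S) (Q : Proc S F.arity V) (z : V) (C : Ty S) :
      Derives F ((x, A) ::ₘ Ω) Q z C → Derives F ((x, .box A) ::ₘ Ω) (.now x Q) z C

/-- The typing judgment `Ω ⊢ P :: (z : C)`, with its presupposition that all channels declared in
the sequent are distinct. Reading any rule from the conclusion to the premises preserves this
presupposition, so it suffices to impose it on the final sequent. -/
def HasType {TName Label PName : Type} {S : TypeDefs TName Label} (F : ProcDefs S PName)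
    {V : Type} (Ω : Ctx S V) (P : Proc S F.arity V) (z : V) (C : Ty S) : Prop :=
  (z ::ₘ Ω.dom).Nodup ∧ Derives F Ω P z C

/-- Every process definition of the signature is well typed. -/
def ProcDefs.WellTyped {TName Label PName : Type} {S : TypeDefs TName Label}
    (F : ProcDefs S PName) : Prop :=
  ∀ f, HasType F (Ctx.ofFn some (F.params f)) (F.body f) none (F.result f)

/-! ## Configurations -/

/-- Messages. A message is a process of a particular form, given by `Msg.toProc`. -/
inductive Msg (Label Chan : Type) : Type
  /-- `c.k ; c ← c'` -/
  | selR (c : Chan) (k : Label) (c' : Chan) : Msg Label Chan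
  /-- `c.k ; c' ← c` -/
  | selL (c : Chan) (k : Label) (c' : Chan) : Msg Label Chan
  /-- `close c` -/
  | close (c : Chan) : Msg Label Chan
  /-- `send c d ; c ← c'` -/
  | sendR (c d c' : Chan) : Msg Label Chan
  /-- `send c d ; c' ← c` -/
  | sendL (c d c' : Chan) : Msg Label Chan
  /-- `now! c ; c ← c'` -/
  | nowR (c c' : Chan) : Msg Label Chan
  /-- `now! c ; c' ← c` -/
  | nowL (c c' : Chan) : Msg Label Chan

namespace Msg

variable {TName Label PName Chan : Type} {S : TypeDefs TName Label}

/-- The process expression that a message is. -/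
def toProc (arity : PName → ℕ) : Msg Label Chan → Proc S arity Chan
  | .selR c k c' => .sel c k (.fwd c c')
  | .selL c k c' => .sel c k (.fwd c' c)
  | .close c => .close c
  | .sendR c d c' => .send c d (.fwd c c')
  | .sendL c d c' => .send c d (.fwd c' c)
  | .nowR c c' => .now c (.fwd c c')
  | .nowL c c' => .now c (.fwd c' c)

/-- Simultaneous substitution of channels. -/
def rename (r : Chan → Chan) : Msg Label Chan → Msg Label Chan
  | .selR c k c' => .selR (r c) k (r c')
  | .selL c k c' => .selL (r c) k (r c')
  | .close c => .close (r c)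
  | .sendR c d c' => .sendR (r c) (r d) (r c')
  | .sendL c d c' => .sendL (r c) (r d) (r c')
  | .nowR c c' => .nowR (r c) (r c')
  | .nowL c c' => .nowL (r c) (r c')

/-- The channels that occur in a message. -/
def free : Msg Label Chan → Set Chan
  | .selR c _ c' => {c, c'}
  | .selL c _ c' => {c, c'}
  | .close c => {c}
  | .sendR c d c' => {c, d, c'}
  | .sendL c d c' => {c, d, c'}
  | .nowR c c' => {c, c'}
  | .nowL c c' => {c, c'}

end Msg

/-- Semantic objects: `proc(c, t, P)` and `msg(c, t, M)` provide `c` and are at time `t`. -/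
inductive Obj {TName Label PName : Type} (S : TypeDefs TName Label) (arity : PName → ℕ)
    (Chan : Type) : Type 1
  | proc (c : Chan) (t : ℕ) (P : Proc S arity Chan) : Obj S arity Chan
  | msg (c : Chan) (t : ℕ) (M : Msg Label Chan) : Obj S arity Chan

namespace Obj

variable {TName Label PName Chan : Type} {S : TypeDefs TName Label} {arity : PName → ℕ}

/-- The channel that an object provides. -/
def provides : Obj S arity Chan → Chan
  | .proc c _ _ => c
  | .msg c _ _ => c

/-- The channels that occur in an object. -/
def channels : Obj S arity Chan → Set Chan
  | .proc c _ P => {v | v = c ∨ v ∈ P.free}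
  | .msg c _ M => {v | v = c ∨ v ∈ M.free}

end Obj

/-- Configurations are multisets of semantic objects. -/
abbrev Config {TName Label PName : Type} (S : TypeDefs TName Label) (arity : PName → ℕ)
    (Chan : Type) : Type 1 :=
  Multiset (Obj S arity Chan)

/-- Derivability of `Ω' ⊨ 𝒞 :: Ω` by the rules `empty`, `compose`, `proc` and `msg`
(see `ConfigTyped`). -/
inductive ConfigDerives {TName Label PName Chan : Type} {S : TypeDefs TName Label}
    (F : ProcDefs S PName) : Ctx S Chan → Config S F.arity Chan → Ctx S Chan → Prop
  | empty (Ω : Ctx S Chan) : ConfigDerives F Ω 0 Ω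
  | compose (Ω₀ Ω₁ Ω₂ : Ctx S Chan) (C₁ C₂ : Config S F.arity Chan) :
      ConfigDerives F Ω₀ C₁ Ω₁ → ConfigDerives F Ω₁ C₂ Ω₂ → ConfigDerives F Ω₀ (C₁ + C₂) Ω₂
  | proc (Ω₀ Ω' Ω Ωt : Ctx S Chan) (c : Chan) (t : ℕ) (P : Proc S F.arity Chan)
      (A At A' : Ty S) :
      Ctx.Lift Ty.WeakSub Ω' Ω →
      Ctx.Lift (Ty.ShiftL t) Ω Ωt → Ty.ShiftR t A At → HasType F Ωt P c At →
      Ty.WeakSub A A' →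
      ConfigDerives F (Ω₀ + Ω') {.proc c t P} ((c, A') ::ₘ Ω₀)
  | msg (Ω₀ Ω' Ω Ωt : Ctx S Chan) (c : Chan) (t : ℕ) (M : Msg Label Chan) (A At A' : Ty S) :
      Ctx.Lift Ty.WeakSub Ω' Ω →
      Ctx.Lift (Ty.ShiftL t) Ω Ωt → Ty.ShiftR t A At → HasType F Ωt (M.toProc F.arity) c At →
      Ty.WeakSub A A' →
      ConfigDerives F (Ω₀ + Ω') {.msg c t M} ((c, A') ::ₘ Ω₀)

/-- The typing judgment `Ω' ⊨ 𝒞 :: Ω` for configurations. It carries the stipulation that no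
channel has two providers; here the channels in `Ω'` are provided by the environment with which
`𝒞` is composed, so they are distinct from each other and from those provided in `𝒞`. -/
def ConfigTyped {TName Label PName Chan : Type} {S : TypeDefs TName Label}
    (F : ProcDefs S PName) (Ω' : Ctx S Chan) (C : Config S F.arity Chan) (Ω : Ctx S Chan) : Prop :=
  (Ω'.dom + C.map Obj.provides).Nodup ∧ ConfigDerives F Ω' C Ω

/-! ## Timed multiset rewriting -/

section Dynamics

variable {Chan : Type} [DecidableEq Chan]

/-- The substitution `[c'/c]`. -/
def subst (c' c : Chan) : Chan → Chan := fun v => if v = c then c' else v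

/-- The substitution `[a/x]` for the bound variable `x`. -/
def inst (a : Chan) : Option Chan → Chan
  | none => a
  | some v => v

/-- The simultaneous substitution `[c', d/c, x]` for the channel `c` and the bound variable `x`. -/
def substInst (c' c d : Chan) : Option Chan → Chan
  | none => d
  | some v => subst c' c v

/-- The substitution `[a/x, es/Ω_f]` into the body of a process definition. -/
def instBody {n : ℕ} (a : Chan) (es : Fin n → Chan) : Option (Fin n) → Chan
  | none => a
  | some i => es i

/-- The rewriting rules. `N` is the set of channels in use; a channel is fresh if it is not in
`N`. In the rules for a sending client the channel `c` is not the one that the process provides. -/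
inductive Rule {TName Label PName : Type} {S : TypeDefs TName Label} (F : ProcDefs S PName)
    (N : Set Chan) : Config S F.arity Chan → Config S F.arity Chan → Prop
  | cutC (c a : Chan) (t : ℕ) (A : Ty S) (P Q : Proc S F.arity (Option Chan)) :
      a ∉ N →
      Rule F N {.proc c t (.cut A P Q)}
        {.proc a t (P.rename (inst a)), .proc c t (Q.rename (inst a))}
  | defC (c a : Chan) (t : ℕ) (f : PName) (es : Fin (F.arity f) → Chan)
      (Q : Proc S F.arity (Option Chan)) :
      a ∉ N →
      Rule F N {.proc c t (.call f es Q)}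
        {.proc a t ((F.body f).rename (instBody a es)), .proc c t (Q.rename (inst a))}
  | idPosC (c d : Chan) (s t : ℕ) (M : Msg Label Chan) :
      s ≤ t →
      Rule F N {.msg d t M, .proc c s (.fwd c d)} {.msg c t (M.rename (subst c d))}
  | idNegC (c d e : Chan) (s t : ℕ) (M : Msg Label Chan) :
      c ∈ M.free → s ≤ t →
      Rule F N {.proc c s (.fwd c d), .msg e t M} {.msg e t (M.rename (subst d c))}
  | plusS (c c' : Chan) (t : ℕ) (k : Label) (P : Proc S F.arity Chan) :
      c' ∉ N →
      Rule F N {.proc c t (.sel c k P)}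
        {.proc c' t (P.rename (subst c' c)), .msg c t (.selR c k c')}
  | plusC (c c' d : Chan) (t : ℕ) (L : Finset Label) (k : {l // l ∈ L})
      (Q : {l // l ∈ L} → Proc S F.arity Chan) :
      Rule F N {.msg c t (.selR c k c'), .proc d t (.case c L Q)}
        {.proc d t ((Q k).rename (subst c' c))}
  | ampS (c c' d : Chan) (t : ℕ) (k : Label) (Q : Proc S F.arity Chan) :
      c ≠ d → c' ∉ N →
      Rule F N {.proc d t (.sel c k Q)}
        {.msg c' t (.selL c k c'), .proc d t (Q.rename (subst c' c))}
  | ampC (c c' : Chan) (t : ℕ) (L : Finset Label) (k : {l // l ∈ L})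
      (Q : {l // l ∈ L} → Proc S F.arity Chan) :
      Rule F N {.proc c t (.case c L Q), .msg c' t (.selL c k c')}
        {.proc c' t ((Q k).rename (subst c' c))}
  | oneS (c : Chan) (t : ℕ) :
      Rule F N {.proc c t (.close c)} {.msg c t (.close c)}
  | oneC (c d : Chan) (t : ℕ) (Q : Proc S F.arity Chan) :
      Rule F N {.msg c t (.close c), .proc d t (.wait c Q)} {.proc d t Q}
  | tensorS (c c' d : Chan) (t : ℕ) (P : Proc S F.arity Chan) :
      c' ∉ N →
      Rule F N {.proc c t (.send c d P)}
        {.proc c' t (P.rename (subst c' c)), .msg c t (.sendR c d c')}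
  | tensorC (c c' d e : Chan) (t : ℕ) (Q : Proc S F.arity (Option Chan)) :
      Rule F N {.msg c t (.sendR c d c'), .proc e t (.recv c Q)}
        {.proc e t (Q.rename (substInst c' c d))}
  | lolliS (c c' d e : Chan) (t : ℕ) (Q : Proc S F.arity Chan) :
      c ≠ e → c' ∉ N →
      Rule F N {.proc e t (.send c d Q)}
        {.msg c' t (.sendL c d c'), .proc e t (Q.rename (subst c' c))}
  | lolliC (c c' d : Chan) (t : ℕ) (P : Proc S F.arity (Option Chan)) :
      Rule F N {.proc c t (.recv c P), .msg c' t (.sendL c d c')}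
        {.proc c' t (P.rename (substInst c' c d))}
  | nextC (c : Chan) (t : ℕ) (P : Proc S F.arity Chan) :
      Rule F N {.proc c t (.delay P)} {.proc c (t + 1) P}
  | diaS (c c' : Chan) (t : ℕ) (P : Proc S F.arity Chan) :
      c' ∉ N →
      Rule F N {.proc c t (.now c P)}
        {.proc c' t (P.rename (subst c' c)), .msg c t (.nowR c c')}
  | diaC (c c' d : Chan) (s t : ℕ) (Q : Proc S F.arity Chan) :
      s ≤ t →
      Rule F N {.msg c t (.nowR c c'), .proc d s (.when c Q)}
        {.proc d t (Q.rename (subst c' c))}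
  | boxS (c c' d : Chan) (t : ℕ) (Q : Proc S F.arity Chan) :
      c ≠ d → c' ∉ N →
      Rule F N {.proc d t (.now c Q)}
        {.msg c' t (.nowL c c'), .proc d t (Q.rename (subst c' c))}
  | boxC (c c' : Chan) (s t : ℕ) (P : Proc S F.arity Chan) :
      s ≤ t →
      Rule F N {.proc c s (.when c P), .msg c' t (.nowL c c')}
        {.proc c' t (P.rename (subst c' c))}

/-- The transition `𝒞 ↦ 𝒟`: a rule rewrites a part of `𝒞` and leaves the rest unchanged. Fresh
channels neither occur in `𝒞` nor belong to the set `X` of channels of the environment. -/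
def Step {TName Label PName : Type} {S : TypeDefs TName Label} (F : ProcDefs S PName)
    (X : Set Chan) (C D : Config S F.arity Chan) : Prop :=
  ∃ lhs rhs rest : Config S F.arity Chan,
    C = lhs + rest ∧ D = rhs + rest ∧
      Rule F (X ∪ {v | ∃ o ∈ C, v ∈ o.channels}) lhs rhs

end Dynamics

end TemporalSession

/-! All timing information is expressed by the preorder `WeakSub`. A left shift of `A` by `t` to `B`
gives A <: ○ᵗB, a right shift gives ○ᵗB <: A, and ○ᵗB itself shifts to `B` on either side. Hence the
rule for an object at time `t`, with its shifts and two subtypings, amounts to U <: ○ᵗΩt, Ωt ⊢ P ::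
(c : At) and ○ᵗAt <: A, which is `ObjTyped`.

When a provider at time `t` and a client at time `s` meet on a channel, their judgments chain to ○ᵗB
<: ○ˢB'. If t = s, the delays cancel (`WeakSub.of_nextN`) and a non-temporal head forces B = B'
(`WeakSub.eq_of_head`). For □ and ◇ the times may differ, but subtyping still determines the body
(`WeakSub.nextN_box_inj`, `WeakSub.nextN_dia_inj`); the delayedness premises of `when?` are what
allows the waiting process to jump to the later time of the message. A forward only contributes one
more subtyping to a chain.

A configuration derivation is linearised into a sequence with providers before clients
(`configSeq_iff`). A step on one object acts in place (`ConfigSeq.replace`). For two objects,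
distinctness and linearity ensure that nothing between provider and client uses their common
channel, so the objects in between can be typed before both and the pair becomes adjacent
(`ConfigSeq.split_client`, `ConfigSeq.merge`). Every rewriting rule thus follows one of the patterns
`ConfigTyped.relabel`, `ConfigTyped.spawn` and `ConfigTyped.merge`, plus a statement about the
objects involved, obtained by inversion and renaming of typing derivations. -/

namespace TemporalSession

/-! ### Injectivity and disjointness of type constructors, weak subtyping, time shifts -/

namespace Ty

variable {TName Label : Type} {S : TypeDefs TName Label}

theorem tyEq_iff {A B : TyExp TName Label} : (mk A : Ty S) = mk B ↔ S.TyEq A B :=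
  ⟨fun h => Quotient.exact (s := S.setoid) h, fun h => Quotient.sound (s := S.setoid) h⟩

theorem mk_rep (A : Ty S) : mk A.rep = A := Quotient.out_eq (s := S.setoid) A

theorem rep_tyEq {A B : Ty S} : S.TyEq A.rep B.rep ↔ A = B := by
  rw [← tyEq_iff, mk_rep, mk_rep]

/-- Equal types have unfoldings with the same outermost constructor and equal components. -/
theorem sameHead_of_mk_eq {A B : TyExp TName Label} (h : (mk A : Ty S) = mk B) :
    SameHead S.TyEq (S.unfold A) (S.unfold B) := by
  obtain ⟨R, hR, hs⟩ := tyEq_iff.1 h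
  have h2 := hs _ _ hR
  generalize S.unfold A = A' at h2
  generalize S.unfold B = B' at h2
  cases h2 <;> constructor <;>
    first | exact ⟨R, by assumption, hs⟩ | exact fun l => ⟨R, by solve_by_elim, hs⟩

theorem next_injective : Function.Injective (next : Ty S → Ty S) := by
  intro A B h
  have h := sameHead_of_mk_eq h
  cases h with
  | next _ _ h => exact rep_tyEq.1 h

theorem box_injective : Function.Injective (box : Ty S → Ty S) := by
  intro A B h
  have h := sameHead_of_mk_eq h
  cases h with
  | box _ _ h => exact rep_tyEq.1 h

theorem dia_injective : Function.Injective (dia : Ty S → Ty S) := by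
  intro A B h
  have h := sameHead_of_mk_eq h
  cases h with
  | dia _ _ h => exact rep_tyEq.1 h

theorem tensor_inj {A B A' B' : Ty S} (h : tensor A B = tensor A' B') : A = A' ∧ B = B' := by
  have h := sameHead_of_mk_eq h
  cases h with
  | tensor _ _ _ _ h h' => exact ⟨rep_tyEq.1 h, rep_tyEq.1 h'⟩

theorem lolli_inj {A B A' B' : Ty S} (h : lolli A B = lolli A' B') : A = A' ∧ B = B' := by
  have h := sameHead_of_mk_eq h
  cases h with
  | lolli _ _ _ _ h h' => exact ⟨rep_tyEq.1 h, rep_tyEq.1 h'⟩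

/-- Components are compared label by label, under arbitrary membership proofs, which avoids
transport along the equality of label sets. -/
theorem plus_inj {L L' : Finset Label} {A : {l // l ∈ L} → Ty S} {A' : {l // l ∈ L'} → Ty S}
    (h : plus L A = plus L' A') : L = L' ∧ ∀ l hl hl', A ⟨l, hl⟩ = A' ⟨l, hl'⟩ := by
  have h := sameHead_of_mk_eq h
  simp only [TypeDefs.unfold] at h
  -- The families depend on the label sets; as variables they let `cases` identify `L` with `L'`.
  generalize hB : (fun l => (A l).rep) = B at h
  generalize hB' : (fun l => (A' l).rep) = B' at h
  cases h with
  | plus _ _ _ h =>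
    subst hB hB'
    exact ⟨rfl, fun l hl _ => rep_tyEq.1 (h ⟨l, hl⟩)⟩

theorem amp_inj {L L' : Finset Label} {A : {l // l ∈ L} → Ty S} {A' : {l // l ∈ L'} → Ty S}
    (h : amp L A = amp L' A') : L = L' ∧ ∀ l hl hl', A ⟨l, hl⟩ = A' ⟨l, hl'⟩ := by
  have h := sameHead_of_mk_eq h
  simp only [TypeDefs.unfold] at h
  generalize hB : (fun l => (A l).rep) = B at h
  generalize hB' : (fun l => (A' l).rep) = B' at h
  cases h with
  | amp _ _ _ h =>
    subst hB hB'
    exact ⟨rfl, fun l hl _ => rep_tyEq.1 (h ⟨l, hl⟩)⟩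

theorem next_ne_box (A B : Ty S) : next A ≠ box B := fun h => nomatch sameHead_of_mk_eq h

theorem next_ne_dia (A B : Ty S) : next A ≠ dia B := fun h => nomatch sameHead_of_mk_eq h

theorem box_ne_dia (A B : Ty S) : box A ≠ dia B := fun h => nomatch sameHead_of_mk_eq h

theorem nextN_succ (n : ℕ) (A : Ty S) : nextN (n + 1) A = next (nextN n A) :=
  Function.iterate_succ_apply' next n A

theorem nextN_add (m n : ℕ) (A : Ty S) : nextN (m + n) A = nextN m (nextN n A) :=
  Function.iterate_add_apply next m n A

/-- Since ○ is injective and never equal to a □, the leading ○s can be counted even in an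
equi-recursive type. -/
theorem nextN_box_inj {m n : ℕ} {A B : Ty S} (h : nextN m (box A) = nextN n (box B)) :
    m = n ∧ A = B := by
  induction m generalizing n with
  | zero =>
    cases n with
    | zero => exact ⟨rfl, box_injective h⟩
    | succ n => rw [nextN_succ] at h; exact absurd h.symm (next_ne_box _ _)
  | succ m ih =>
    rw [nextN_succ] at h
    cases n with
    | zero => exact absurd h (next_ne_box _ _)
    | succ n =>
      rw [nextN_succ] at h
      obtain ⟨rfl, rfl⟩ := ih (next_injective h)
      exact ⟨rfl, rfl⟩

theorem nextN_dia_inj {m n : ℕ} {A B : Ty S} (h : nextN m (dia A) = nextN n (dia B)) :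
    m = n ∧ A = B := by
  induction m generalizing n with
  | zero =>
    cases n with
    | zero => exact ⟨rfl, dia_injective h⟩
    | succ n => rw [nextN_succ] at h; exact absurd h.symm (next_ne_dia _ _)
  | succ m ih =>
    rw [nextN_succ] at h
    cases n with
    | zero => exact absurd h (next_ne_dia _ _)
    | succ n =>
      rw [nextN_succ] at h
      obtain ⟨rfl, rfl⟩ := ih (next_injective h)
      exact ⟨rfl, rfl⟩

theorem nextN_box_ne_nextN_dia (m n : ℕ) (A B : Ty S) : nextN m (box A) ≠ nextN n (dia B) := by
  intro h
  induction m generalizing n with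
  | zero =>
    cases n with
    | zero => exact box_ne_dia _ _ h
    | succ n => rw [nextN_succ] at h; exact next_ne_box _ _ h.symm
  | succ m ih =>
    rw [nextN_succ] at h
    cases n with
    | zero => exact next_ne_dia _ _ h
    | succ n => rw [nextN_succ] at h; exact ih _ (next_injective h)

/-! ### Weak subtyping -/

/-- The indices of `WeakSub` are iterated ○s in a quotient rather than constructor patterns; as
explicit equations they can be inverted by the injectivity lemmas. -/
theorem weakSub_iff {A B : Ty S} : WeakSub A B ↔ A = B ∨
    (∃ m n D, m ≤ n ∧ A = nextN m (box D) ∧ B = nextN n (box D)) ∨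
    ∃ m n D, n ≤ m ∧ A = nextN m (dia D) ∧ B = nextN n (dia D) := by
  constructor
  · rintro (⟨m, n, D, h⟩ | ⟨m, n, D, h⟩ | _)
    · exact .inr (.inl ⟨m, n, D, h, rfl, rfl⟩)
    · exact .inr (.inr ⟨m, n, D, h, rfl, rfl⟩)
    · exact .inl rfl
  · rintro (rfl | ⟨m, n, D, h, rfl, rfl⟩ | ⟨m, n, D, h, rfl, rfl⟩)
    · exact .refl _
    · exact .box _ _ _ h
    · exact .dia _ _ _ h

/-- A delayed □ is never a delayed ◇, so two proper steps are of the same kind; they share the body,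
and their inequalities between delays compose. -/
theorem WeakSub.trans {A B C : Ty S} (h : WeakSub A B) (h' : WeakSub B C) : WeakSub A C := by
  rcases weakSub_iff.1 h with rfl | ⟨m, n, D, hmn, rfl, rfl⟩ | ⟨m, n, D, hmn, rfl, rfl⟩
  · exact h'
  · rcases weakSub_iff.1 h' with rfl | ⟨m', n', D', hmn', h1, rfl⟩ | ⟨m', n', D', hmn', h1, rfl⟩
    · exact h
    · obtain ⟨rfl, rfl⟩ := nextN_box_inj h1
      exact .box _ _ _ (hmn.trans hmn')
    · exact absurd h1 (nextN_box_ne_nextN_dia _ _ _ _)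
  · rcases weakSub_iff.1 h' with rfl | ⟨m', n', D', hmn', h1, rfl⟩ | ⟨m', n', D', hmn', h1, rfl⟩
    · exact h
    · exact absurd h1.symm (nextN_box_ne_nextN_dia _ _ _ _)
    · obtain ⟨rfl, rfl⟩ := nextN_dia_inj h1
      exact .dia _ _ _ (hmn'.trans hmn)

theorem WeakSub.nextN (t : ℕ) {A B : Ty S} (h : WeakSub A B) :
    WeakSub (nextN t A) (nextN t B) := by
  rcases weakSub_iff.1 h with rfl | ⟨m, n, D, hmn, rfl, rfl⟩ | ⟨m, n, D, hmn, rfl, rfl⟩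
  · exact .refl _
  · rw [← nextN_add, ← nextN_add]; exact .box _ _ _ (by omega)
  · rw [← nextN_add, ← nextN_add]; exact .dia _ _ _ (by omega)

/-- The outer ○ excludes delay 0 on both sides, so both delays can be lowered by one. -/
theorem WeakSub.of_next {A B : Ty S} (h : WeakSub (next A) (next B)) : WeakSub A B := by
  rcases weakSub_iff.1 h with h | ⟨m, n, D, hmn, h1, h2⟩ | ⟨m, n, D, hmn, h1, h2⟩
  · rw [next_injective h]; exact .refl _
  · obtain _ | m := m
    · exact absurd h1 (next_ne_box _ _)
    obtain _ | n := n
    · exact absurd h2 (next_ne_box _ _)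
    rw [nextN_succ] at h1 h2
    rw [next_injective h1, next_injective h2]
    exact .box _ _ _ (by omega)
  · obtain _ | m := m
    · exact absurd h1 (next_ne_dia _ _)
    obtain _ | n := n
    · exact absurd h2 (next_ne_dia _ _)
    rw [nextN_succ] at h1 h2
    rw [next_injective h1, next_injective h2]
    exact .dia _ _ _ (by omega)

theorem WeakSub.of_nextN {t : ℕ} {A B : Ty S} (h : WeakSub (Ty.nextN t A) (Ty.nextN t B)) :
    WeakSub A B := by
  induction t with
  | zero => exact h
  | succ t ih => rw [nextN_succ, nextN_succ] at h; exact ih h.of_next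

/-- A type whose head is not temporal is a weak subtype only of itself. -/
theorem WeakSub.eq_of_head {A B : Ty S} (h : WeakSub A B) (h1 : ∀ D, A ≠ Ty.next D)
    (h2 : ∀ D, A ≠ Ty.box D) (h3 : ∀ D, A ≠ Ty.dia D) : A = B := by
  rcases weakSub_iff.1 h with h | ⟨m, n, D, hmn, h, -⟩ | ⟨m, n, D, hmn, h, -⟩
  · exact h
  · cases m with
    | zero => exact absurd h (h2 _)
    | succ m => rw [nextN_succ] at h; exact absurd h (h1 _)
  · cases m with
    | zero => exact absurd h (h3 _)
    | succ m => rw [nextN_succ] at h; exact absurd h (h1 _)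

theorem WeakSub.plus_eq {L : Finset Label} {A : {l // l ∈ L} → Ty S} {B : Ty S}
    (h : WeakSub (plus L A) B) : plus L A = B :=
  h.eq_of_head (fun _ h => nomatch sameHead_of_mk_eq h) (fun _ h => nomatch sameHead_of_mk_eq h)
    (fun _ h => nomatch sameHead_of_mk_eq h)

theorem WeakSub.amp_eq {L : Finset Label} {A : {l // l ∈ L} → Ty S} {B : Ty S}
    (h : WeakSub (amp L A) B) : amp L A = B :=
  h.eq_of_head (fun _ h => nomatch sameHead_of_mk_eq h) (fun _ h => nomatch sameHead_of_mk_eq h)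
    (fun _ h => nomatch sameHead_of_mk_eq h)

theorem WeakSub.tensor_eq {A A' B : Ty S} (h : WeakSub (tensor A A') B) : tensor A A' = B :=
  h.eq_of_head (fun _ h => nomatch sameHead_of_mk_eq h) (fun _ h => nomatch sameHead_of_mk_eq h)
    (fun _ h => nomatch sameHead_of_mk_eq h)

theorem WeakSub.lolli_eq {A A' B : Ty S} (h : WeakSub (lolli A A') B) : lolli A A' = B :=
  h.eq_of_head (fun _ h => nomatch sameHead_of_mk_eq h) (fun _ h => nomatch sameHead_of_mk_eq h)
    (fun _ h => nomatch sameHead_of_mk_eq h)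

/-- The delays are unrelated on purpose: a `now!` message and its recipient may be at different
times. -/
theorem WeakSub.nextN_box_inj {m n : ℕ} {A B : Ty S}
    (h : WeakSub (Ty.nextN m (Ty.box A)) (Ty.nextN n (Ty.box B))) : A = B := by
  rcases weakSub_iff.1 h with h | ⟨m, n, D, hmn, h1, h2⟩ | ⟨m, n, D, hmn, h1, h2⟩
  · exact (Ty.nextN_box_inj h).2
  · exact (Ty.nextN_box_inj h1).2.trans (Ty.nextN_box_inj h2).2.symm
  · exact absurd h1 (nextN_box_ne_nextN_dia _ _ _ _)

theorem WeakSub.nextN_dia_inj {m n : ℕ} {A B : Ty S}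
    (h : WeakSub (Ty.nextN m (Ty.dia A)) (Ty.nextN n (Ty.dia B))) : A = B := by
  rcases weakSub_iff.1 h with h | ⟨m, n, D, hmn, h1, h2⟩ | ⟨m, n, D, hmn, h1, h2⟩
  · exact (Ty.nextN_dia_inj h).2
  · exact absurd h1.symm (nextN_box_ne_nextN_dia _ _ _ _)
  · exact (Ty.nextN_dia_inj h1).2.trans (Ty.nextN_dia_inj h2).2.symm

/-- The additional ○s are absorbed by the delay in front of the □; this lets a process waiting at
time `s` use its channels at the later time `t`. The ◇ version does the same for the provided
channel, in the opposite direction. -/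
theorem DelayedBox.weakSub_nextN {A : Ty S} (h : DelayedBox A) {s t : ℕ} (hst : s ≤ t) :
    WeakSub (Ty.nextN s A) (Ty.nextN t A) := by
  obtain ⟨n, B, rfl⟩ := h
  rw [← nextN_add, ← nextN_add]
  exact .box _ _ _ (by omega)

theorem DelayedDia.weakSub_nextN {A : Ty S} (h : DelayedDia A) {s t : ℕ} (hst : s ≤ t) :
    WeakSub (Ty.nextN t A) (Ty.nextN s A) := by
  obtain ⟨n, B, rfl⟩ := h
  rw [← nextN_add, ← nextN_add]
  exact .dia _ _ _ (by omega)

/-! ### Time shifts in terms of weak subtyping -/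

theorem ShiftL1.weakSub {A B : Ty S} (h : ShiftL1 A B) : WeakSub A (Ty.next B) := by
  cases h with
  | next => exact .refl _
  -- A □ that persists through the shift is a □ whose delay grows from 0 to 1.
  | box A => exact .box 0 1 A zero_le_one

theorem ShiftR1.weakSub {A B : Ty S} (h : ShiftR1 A B) : WeakSub (Ty.next B) A := by
  cases h with
  | next => exact .refl _
  | dia A => exact .dia 1 0 A zero_le_one

theorem ShiftL1.weakSub_nextN {A B : Ty S} (h : ShiftL1 A B) (t : ℕ) :
    WeakSub (nextN t A) (nextN (t + 1) B) := by
  rw [nextN_add]; exact h.weakSub.nextN t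

theorem ShiftR1.weakSub_nextN {A B : Ty S} (h : ShiftR1 A B) (t : ℕ) :
    WeakSub (nextN (t + 1) B) (nextN t A) := by
  rw [nextN_add]; exact h.weakSub.nextN t

theorem ShiftL.weakSub {t : ℕ} {A B : Ty S} (h : ShiftL t A B) : WeakSub A (nextN t B) := by
  induction h with
  | zero A => exact .refl _
  | succ t A B C _ h ih => exact ih.trans (h.weakSub_nextN t)

theorem ShiftR.weakSub {t : ℕ} {A B : Ty S} (h : ShiftR t A B) : WeakSub (nextN t B) A := by
  induction h with
  | zero A => exact .refl _
  | succ t A B C _ h ih => exact (h.weakSub_nextN t).trans ih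

theorem shiftL_nextN (t : ℕ) (A : Ty S) : ShiftL t (nextN t A) A := by
  induction t generalizing A with
  | zero => exact .zero _
  -- The last unit shift removes the innermost ○, so ○ᵗ⁺¹A is read as ○ᵗ(○A).
  | succ t ih => rw [nextN_add]; exact .succ _ _ _ _ (ih _) (.next A)

theorem shiftR_nextN (t : ℕ) (A : Ty S) : ShiftR t (nextN t A) A := by
  induction t generalizing A with
  | zero => exact .zero _
  | succ t ih => rw [nextN_add]; exact .succ _ _ _ _ (ih _) (.next A)

end Ty

/-! ### Contexts and pointwise relations between them -/

namespace Ctx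

variable {TName Label : Type} {S : TypeDefs TName Label} {V W : Type}

/-- Renaming of the channels declared in a context. -/
def rename (Ω : Ctx S V) (r : V → W) : Ctx S W := Ω.map fun p => (r p.1, p.2)

@[simp] theorem dom_zero : dom (0 : Ctx S V) = 0 := rfl

@[simp] theorem dom_cons (p : V × Ty S) (Ω : Ctx S V) : dom (p ::ₘ Ω) = p.1 ::ₘ dom Ω :=
  Multiset.map_cons _ _ _

@[simp] theorem dom_singleton (p : V × Ty S) : dom ({p} : Ctx S V) = {p.1} := rfl

@[simp] theorem dom_add (Ω Ω' : Ctx S V) : dom (Ω + Ω') = dom Ω + dom Ω' :=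
  Multiset.map_add _ _ _

theorem mem_dom {Ω : Ctx S V} {v : V} : v ∈ Ω.dom ↔ ∃ A, (v, A) ∈ Ω := by
  simp [dom]

@[simp] theorem rename_cons (p : V × Ty S) (Ω : Ctx S V) (r : V → W) :
    rename (p ::ₘ Ω) r = (r p.1, p.2) ::ₘ rename Ω r := Multiset.map_cons _ _ _

@[simp] theorem rename_add (Ω Ω' : Ctx S V) (r : V → W) :
    rename (Ω + Ω') r = rename Ω r + rename Ω' r := Multiset.map_add _ _ _

theorem weaken_rename_map (Ω : Ctx S V) (r : V → W) :
    Ω.weaken.rename (Option.map r) = (Ω.rename r).weaken := by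
  simp [weaken, rename, Multiset.map_map]

theorem ofFn_rename {n : ℕ} (e : Fin n → V) (A : Fin n → Ty S) (r : V → W) :
    (ofFn e A).rename r = ofFn (fun i => r (e i)) A := by
  unfold ofFn rename
  rw [Multiset.map_map]
  rfl

theorem rename_eq_self {Ω : Ctx S V} {r : V → V} (h : ∀ v ∈ Ω.dom, r v = v) :
    Ω.rename r = Ω := by
  conv_rhs => rw [← Multiset.map_id' Ω]
  refine Multiset.map_congr rfl fun p hp => ?_
  rw [h p.1 (mem_dom.2 ⟨p.2, hp⟩)]

theorem weaken_rename_eq_self {Ω : Ctx S V} {r : Option V → V} (h : ∀ v ∈ Ω.dom, r (some v) = v) :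
    Ω.weaken.rename r = Ω := by
  have : Ω.weaken.rename r = Ω.rename fun v => r (some v) := by
    simp [weaken, rename, Multiset.map_map]
  rw [this]
  exact rename_eq_self h

theorem DelayedBox.rename {Ω : Ctx S V} (h : Ω.DelayedBox) (r : V → W) :
    Ctx.DelayedBox (Ω.rename r) := by
  intro p hp
  obtain ⟨q, hq, rfl⟩ := Multiset.mem_map.1 hp
  exact h q hq

variable {R R' R'' : Ty S → Ty S → Prop}

theorem Lift.rename {Ω Ω' : Ctx S V} (h : Lift R Ω Ω') (r : V → W) :
    Lift R (Ω.rename r) (Ω'.rename r) :=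
  Multiset.rel_map.2 (h.mono fun _ _ _ _ h => ⟨congrArg r h.1, h.2⟩)

theorem Lift.dom_eq {Ω Ω' : Ctx S V} (h : Lift R Ω Ω') : Ω.dom = Ω'.dom := by
  unfold Lift at h
  induction h with
  | zero => rfl
  | cons h _ ih => rw [dom_cons, dom_cons, h.1, ih]

theorem Lift.comp {Ω Ω' Ω'' : Ctx S V} (h : Lift R Ω Ω') (h' : Lift R' Ω' Ω'')
    (H : ∀ A B C, R A B → R' B C → R'' A C) : Lift R'' Ω Ω'' := by
  unfold Lift at h
  induction h generalizing Ω'' with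
  | zero => rw [Multiset.rel_zero_left.1 h']; exact .zero
  | cons h _ ih =>
    obtain ⟨q, Ωq, hq, hΩ, rfl⟩ := Multiset.rel_cons_left.1 h'
    exact .cons ⟨h.1.trans hq.1, H _ _ _ h.2 hq.2⟩ (ih hΩ)

/-- Inverting a typing derivation splits the shifted context; this lemma and the next two carry the
split back to the context of channels actually used. -/
theorem Lift.cons_right {U Ω : Ctx S V} {c : V} {A : Ty S} (h : Lift R U ((c, A) ::ₘ Ω)) :
    ∃ B U', R B A ∧ Lift R U' Ω ∧ U = (c, B) ::ₘ U' := by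
  obtain ⟨⟨c', B⟩, U', hp, hU, rfl⟩ := Multiset.rel_cons_right.1 h
  obtain rfl : c' = c := hp.1
  exact ⟨B, U', hp.2, hU, rfl⟩

theorem Lift.add_right {U Ω Ω' : Ctx S V} (h : Lift R U (Ω + Ω')) :
    ∃ U₁ U₂ : Ctx S V, Lift R U₁ Ω ∧ Lift R U₂ Ω' ∧ U = U₁ + U₂ :=
  Multiset.rel_add_right.1 h

theorem Lift.singleton_right {U : Ctx S V} {c : V} {A : Ty S} (h : Lift R U {(c, A)}) :
    ∃ B, R B A ∧ U = {(c, B)} := by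
  obtain ⟨B, U', hB, hU, rfl⟩ := Lift.cons_right (Ω := 0) h
  exact ⟨B, hB, by rw [Multiset.rel_zero_right.1 hU]; rfl⟩

theorem Lift.cons {U Ω : Ctx S V} {c : V} {A B : Ty S} (hA : R A B) (h : Lift R U Ω) :
    Lift R ((c, A) ::ₘ U) ((c, B) ::ₘ Ω) :=
  Multiset.Rel.cons ⟨rfl, hA⟩ h

theorem Lift.singleton {c : V} {A B : Ty S} (hA : R A B) :
    Lift R ({(c, A)} : Ctx S V) {(c, B)} :=
  Lift.cons hA .zero

/-- Related declarations have the same channel, so the single declaration of `c` on the right must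
be matched with the given one on the left. -/
theorem Lift.cons_cons {U Ω : Ctx S V} {c : V} {A B : Ty S}
    (h : Lift R ((c, A) ::ₘ U) ((c, B) ::ₘ Ω)) (hc : c ∉ Ω.dom) : R A B ∧ Lift R U Ω := by
  obtain ⟨p, Ω₁, hp, hΩ, he⟩ := Multiset.rel_cons_left.1 h
  rcases Multiset.cons_eq_cons.1 he with ⟨rfl, rfl⟩ | ⟨-, Ω₂, rfl, rfl⟩
  · exact ⟨hp.2, hΩ⟩
  · rw [dom_cons] at hc
    exact absurd (Multiset.mem_cons.2 (.inl hp.1)) hc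

theorem Lift.cons_singleton {U : Ctx S V} {c : V} {A B : Ty S}
    (h : Lift R ((c, A) ::ₘ U) {(c, B)}) : R A B ∧ U = 0 := by
  obtain ⟨h1, h2⟩ := Lift.cons_cons (Ω := 0) h (Multiset.notMem_zero _)
  exact ⟨h1, Multiset.rel_zero_right.1 h2⟩

end Ctx

/-! ### Renaming of channels in typing derivations -/

section Renaming

variable {TName Label PName : Type} {S : TypeDefs TName Label} {F : ProcDefs S PName}

/-- Typing derivations are stable under arbitrary renaming of channels. -/
theorem Derives.rename {V : Type} {Ω : Ctx S V} {P : Proc S F.arity V} {z : V} {C : Ty S}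
    (h : Derives F Ω P z C) {W : Type} (r : V → W) :
    Derives F (Ω.rename r) (P.rename r) (r z) C := by
  induction h generalizing W with
  | cut Ω Ω' A C P Q z _ _ ihP ihQ =>
    rw [Ctx.rename_add, Proc.rename]
    refine .cut _ _ _ _ _ _ _ ?_ ?_
    · simpa [Ctx.weaken_rename_map] using ihP (Option.map r)
    · simpa [Ctx.weaken_rename_map] using ihQ (Option.map r)
  | call Ω f es C Q z _ ih =>
    rw [Ctx.rename_add, Proc.rename, Ctx.ofFn_rename]
    refine .call _ _ _ _ _ _ ?_
    simpa [Ctx.weaken_rename_map] using ih (Option.map r)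
  | id x y A => exact .id _ _ _
  | plusR Ω x L A k P _ ih => exact .plusR _ _ _ _ _ _ (ih r)
  | plusL Ω x L A Q z C _ ih =>
    rw [Ctx.rename_cons, Proc.rename]
    exact .plusL _ _ _ _ _ _ _ fun l => by simpa using ih l r
  | ampR Ω x L A P _ ih => exact .ampR _ _ _ _ _ fun l => ih l r
  | ampL Ω x L A k Q z C _ ih =>
    rw [Ctx.rename_cons, Proc.rename]
    exact .ampL _ _ _ _ _ _ _ _ (by simpa using ih r)
  | oneR x => exact .oneR _
  | oneL Ω x Q z C _ ih =>
    rw [Ctx.rename_cons, Proc.rename]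
    exact .oneL _ _ _ _ _ (ih r)
  | tensorR Ω x y A B P _ ih =>
    rw [Ctx.rename_cons, Proc.rename]
    exact .tensorR _ _ _ _ _ _ (ih r)
  | tensorL Ω x A B Q z C _ ih =>
    rw [Ctx.rename_cons, Proc.rename]
    exact .tensorL _ _ _ _ _ _ _ (by simpa [Ctx.weaken_rename_map] using ih (Option.map r))
  | lolliR Ω x A B P _ ih =>
    rw [Proc.rename]
    exact .lolliR _ _ _ _ _ (by simpa [Ctx.weaken_rename_map] using ih (Option.map r))
  | lolliL Ω x y A B Q z C _ ih =>
    rw [Ctx.rename_cons, Ctx.rename_cons, Proc.rename]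
    exact .lolliL _ _ _ _ _ _ _ _ (by simpa using ih r)
  | nextLR Ω Ω₁ x A A₁ P hΩ hA _ ih => exact .nextLR _ _ _ _ _ _ (hΩ.rename r) hA (ih r)
  | diaR Ω x A P _ ih => exact .diaR _ _ _ _ (ih r)
  | diaL Ω x A Q z C hΩ _ hC ih =>
    rw [Ctx.rename_cons, Proc.rename]
    exact .diaL _ _ _ _ _ _ (hΩ.rename r) (by simpa using ih r) hC
  | boxR Ω x A P hΩ _ ih => exact .boxR _ _ _ _ (hΩ.rename r) (ih r)
  | boxL Ω x A Q z C _ ih =>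
    rw [Ctx.rename_cons, Proc.rename]
    exact .boxL _ _ _ _ _ _ (by simpa using ih r)

variable {Chan : Type}

theorem Derives.inst_right {Ω : Ctx S Chan} {P : Proc S F.arity (Option Chan)} {A : Ty S}
    (h : Derives F Ω.weaken P none A) (a : Chan) : Derives F Ω (P.rename (inst a)) a A := by
  have h := h.rename (inst a)
  rwa [Ctx.weaken_rename_eq_self fun _ _ => rfl] at h

theorem Derives.inst_left {Ω : Ctx S Chan} {Q : Proc S F.arity (Option Chan)} {z : Chan}
    {A C : Ty S} (h : Derives F ((none, A) ::ₘ Ω.weaken) Q (some z) C) (a : Chan) :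
    Derives F ((a, A) ::ₘ Ω) (Q.rename (inst a)) z C := by
  have h := h.rename (inst a)
  rwa [Ctx.rename_cons, Ctx.weaken_rename_eq_self fun _ _ => rfl] at h

theorem Derives.instBody {f : PName} {P : Proc S F.arity (Option (Fin (F.arity f)))} {A : Ty S}
    (h : Derives F (Ctx.ofFn some (F.params f)) P none A) (a : Chan)
    (es : Fin (F.arity f) → Chan) :
    Derives F (Ctx.ofFn es (F.params f)) (P.rename (instBody a es)) a A := by
  have h := h.rename (TemporalSession.instBody a es)
  rwa [Ctx.ofFn_rename] at h

variable [DecidableEq Chan]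

theorem subst_self (c' c : Chan) : subst c' c c = c' := if_pos rfl

theorem subst_of_ne (c' : Chan) {c v : Chan} (h : v ≠ c) : subst c' c v = v := if_neg h

theorem Ctx.rename_subst {Ω : Ctx S Chan} {c : Chan} (h : c ∉ Ω.dom) (c' : Chan) :
    Ω.rename (subst c' c) = Ω :=
  Ctx.rename_eq_self fun _ hv => subst_of_ne _ fun e => h (e ▸ hv)

theorem Derives.subst_right {Ω : Ctx S Chan} {P : Proc S F.arity Chan} {c : Chan} {A : Ty S}
    (h : Derives F Ω P c A) (hc : c ∉ Ω.dom) (c' : Chan) :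
    Derives F Ω (P.rename (subst c' c)) c' A := by
  simpa [Ctx.rename_subst hc, subst_self] using h.rename (subst c' c)

theorem Derives.subst_left {Ω : Ctx S Chan} {Q : Proc S F.arity Chan} {c z : Chan} {A C : Ty S}
    (h : Derives F ((c, A) ::ₘ Ω) Q z C) (hc : c ∉ Ω.dom) (hz : c ≠ z) (c' : Chan) :
    Derives F ((c', A) ::ₘ Ω) (Q.rename (subst c' c)) z C := by
  simpa [Ctx.rename_subst hc, subst_self, subst_of_ne c' hz.symm] using h.rename (subst c' c)

theorem Derives.substInst_right {Ω : Ctx S Chan} {P : Proc S F.arity (Option Chan)} {c : Chan}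
    {A B : Ty S} (h : Derives F ((none, A) ::ₘ Ω.weaken) P (some c) B) (hc : c ∉ Ω.dom)
    (c' d : Chan) : Derives F ((d, A) ::ₘ Ω) (P.rename (substInst c' c d)) c' B := by
  have h := h.rename (substInst c' c d)
  rw [Ctx.rename_cons,
    Ctx.weaken_rename_eq_self fun v hv => subst_of_ne _ fun (e : v = c) => hc (e ▸ hv)] at h
  simpa [substInst, subst_self] using h

theorem Derives.substInst_left {Ω : Ctx S Chan} {Q : Proc S F.arity (Option Chan)} {c z : Chan}
    {A B C : Ty S} (h : Derives F ((none, A) ::ₘ (some c, B) ::ₘ Ω.weaken) Q (some z) C)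
    (hc : c ∉ Ω.dom) (hz : c ≠ z) (c' d : Chan) :
    Derives F ((d, A) ::ₘ (c', B) ::ₘ Ω) (Q.rename (substInst c' c d)) z C := by
  have h := h.rename (substInst c' c d)
  rw [Ctx.rename_cons, Ctx.rename_cons,
    Ctx.weaken_rename_eq_self fun v hv => subst_of_ne _ fun (e : v = c) => hc (e ▸ hv)] at h
  simpa [substInst, subst_self, subst_of_ne c' hz.symm] using h

end Renaming

/-! ### Inversion of process typing -/

section Inversion

variable {TName Label PName : Type} {S : TypeDefs TName Label} {F : ProcDefs S PName}
  {V : Type} {Ω : Ctx S V} {z x y : V} {C : Ty S}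

theorem HasType.notMem_dom {P : Proc S F.arity V} (h : HasType F Ω P z C) : z ∉ Ω.dom :=
  (Multiset.nodup_cons.1 h.1).1

theorem HasType.nodup_dom {P : Proc S F.arity V} (h : HasType F Ω P z C) : Ω.dom.Nodup :=
  (Multiset.nodup_cons.1 h.1).2

theorem Derives.cut_inv {A : Ty S} {P Q : Proc S F.arity (Option V)}
    (h : Derives F Ω (.cut A P Q) z C) : ∃ Ω₁ Ω₂, Ω = Ω₁ + Ω₂ ∧
      Derives F Ω₂.weaken P none A ∧ Derives F ((none, A) ::ₘ Ω₁.weaken) Q (some z) C := by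
  cases h with
  | cut Ω₁ Ω₂ _ _ _ _ _ h1 h2 => exact ⟨_, _, rfl, h1, h2⟩

theorem Derives.call_inv {f : PName} {es : Fin (F.arity f) → V} {Q : Proc S F.arity (Option V)}
    (h : Derives F Ω (.call f es Q) z C) : ∃ Ω₁, Ω = Ω₁ + Ctx.ofFn es (F.params f) ∧
      Derives F ((none, F.result f) ::ₘ Ω₁.weaken) Q (some z) C := by
  cases h with
  | call Ω₁ _ _ _ _ _ h => exact ⟨_, rfl, h⟩

theorem Derives.fwd_inv (h : Derives F Ω (.fwd x y) z C) : z = x ∧ Ω = {(y, C)} := by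
  cases h with
  | id => exact ⟨rfl, rfl⟩

/-- The competing left rule would declare `x` both as used and as provided, against distinctness.
All the inversions for a provided channel work this way; those for a used channel exclude the right
rule by `x ≠ z`. -/
theorem HasType.sel_right {k : Label} {P : Proc S F.arity V} (h : HasType F Ω (.sel x k P) x C) :
    ∃ L A, ∃ hk : k ∈ L, C = .plus L A ∧ Derives F Ω P x (A ⟨k, hk⟩) := by
  obtain ⟨hn, h⟩ := h
  cases h with
  | plusR _ _ L A k _ h => exact ⟨L, A, k.2, rfl, h⟩
  | ampL => simp at hn

theorem HasType.sel_left {k : Label} {Q : Proc S F.arity V} (h : HasType F Ω (.sel x k Q) z C)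
    (hz : x ≠ z) : ∃ L A Ω₁, ∃ hk : k ∈ L, Ω = (x, .amp L A) ::ₘ Ω₁ ∧
      Derives F ((x, A ⟨k, hk⟩) ::ₘ Ω₁) Q z C := by
  obtain ⟨hn, h⟩ := h
  cases h with
  | plusR => exact absurd rfl hz
  | ampL Ω₁ _ L A k _ _ _ h => exact ⟨L, A, Ω₁, k.2, rfl, h⟩

theorem HasType.case_right {L : Finset Label} {P : {l // l ∈ L} → Proc S F.arity V}
    (h : HasType F Ω (.case x L P) x C) :
    ∃ A, C = .amp L A ∧ ∀ l, Derives F Ω (P l) x (A l) := by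
  obtain ⟨hn, h⟩ := h
  cases h with
  | plusL => simp at hn
  | ampR _ _ _ A _ h => exact ⟨A, rfl, h⟩

theorem HasType.case_left {L : Finset Label} {Q : {l // l ∈ L} → Proc S F.arity V}
    (h : HasType F Ω (.case x L Q) z C) (hz : x ≠ z) :
    ∃ A Ω₁, Ω = (x, .plus L A) ::ₘ Ω₁ ∧ ∀ l, Derives F ((x, A l) ::ₘ Ω₁) (Q l) z C := by
  obtain ⟨hn, h⟩ := h
  cases h with
  | plusL Ω₁ _ _ A _ _ _ h => exact ⟨A, Ω₁, rfl, h⟩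
  | ampR => exact absurd rfl hz

theorem Derives.close_inv (h : Derives F Ω (.close x) z C) : z = x ∧ Ω = 0 ∧ C = .one := by
  cases h with
  | oneR => exact ⟨rfl, rfl, rfl⟩

theorem Derives.wait_inv {Q : Proc S F.arity V} (h : Derives F Ω (.wait x Q) z C) :
    ∃ Ω₁, Ω = (x, .one) ::ₘ Ω₁ ∧ Derives F Ω₁ Q z C := by
  cases h with
  | oneL Ω₁ _ _ _ _ h => exact ⟨Ω₁, rfl, h⟩

theorem HasType.send_right {P : Proc S F.arity V} (h : HasType F Ω (.send x y P) x C) :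
    ∃ A B Ω₁, Ω = (y, A) ::ₘ Ω₁ ∧ C = .tensor A B ∧ Derives F Ω₁ P x B := by
  obtain ⟨hn, h⟩ := h
  cases h with
  | tensorR Ω₁ _ _ A B _ h => exact ⟨A, B, Ω₁, rfl, rfl, h⟩
  | lolliL => simp at hn

theorem HasType.send_left {Q : Proc S F.arity V} (h : HasType F Ω (.send x y Q) z C)
    (hz : x ≠ z) : ∃ A B Ω₁, Ω = (x, .lolli A B) ::ₘ (y, A) ::ₘ Ω₁ ∧
      Derives F ((x, B) ::ₘ Ω₁) Q z C := by
  obtain ⟨hn, h⟩ := h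
  cases h with
  | tensorR => exact absurd rfl hz
  | lolliL Ω₁ _ _ A B _ _ _ h => exact ⟨A, B, Ω₁, rfl, h⟩

theorem HasType.recv_right {P : Proc S F.arity (Option V)} (h : HasType F Ω (.recv x P) x C) :
    ∃ A B, C = .lolli A B ∧ Derives F ((none, A) ::ₘ Ω.weaken) P (some x) B := by
  obtain ⟨hn, h⟩ := h
  cases h with
  | tensorL => simp at hn
  | lolliR _ _ A B _ h => exact ⟨A, B, rfl, h⟩

theorem HasType.recv_left {Q : Proc S F.arity (Option V)} (h : HasType F Ω (.recv x Q) z C)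
    (hz : x ≠ z) : ∃ A B, ∃ Ω₁ : Ctx S V, Ω = (x, .tensor A B) ::ₘ Ω₁ ∧
      Derives F ((none, A) ::ₘ (some x, B) ::ₘ Ω₁.weaken) Q (some z) C := by
  obtain ⟨hn, h⟩ := h
  cases h with
  | tensorL Ω₁ _ A B _ _ _ h => exact ⟨A, B, Ω₁, rfl, h⟩
  | lolliR => exact absurd rfl hz

theorem Derives.delay_inv {P : Proc S F.arity V} (h : Derives F Ω (.delay P) z C) :
    ∃ Ω₁ C₁, Ctx.Lift Ty.ShiftL1 Ω Ω₁ ∧ Ty.ShiftR1 C C₁ ∧ Derives F Ω₁ P z C₁ := by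
  cases h with
  | nextLR _ Ω₁ _ _ C₁ _ h1 h2 h3 => exact ⟨Ω₁, C₁, h1, h2, h3⟩

theorem HasType.now_right {P : Proc S F.arity V} (h : HasType F Ω (.now x P) x C) :
    ∃ A, C = .dia A ∧ Derives F Ω P x A := by
  obtain ⟨hn, h⟩ := h
  cases h with
  | diaR _ _ A _ h => exact ⟨A, rfl, h⟩
  | boxL => simp at hn

theorem HasType.now_left {Q : Proc S F.arity V} (h : HasType F Ω (.now x Q) z C)
    (hz : x ≠ z) : ∃ A Ω₁, Ω = (x, .box A) ::ₘ Ω₁ ∧ Derives F ((x, A) ::ₘ Ω₁) Q z C := by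
  obtain ⟨hn, h⟩ := h
  cases h with
  | diaR => exact absurd rfl hz
  | boxL Ω₁ _ A _ _ _ h => exact ⟨A, Ω₁, rfl, h⟩

theorem HasType.when_right {P : Proc S F.arity V} (h : HasType F Ω (.when x P) x C) :
    ∃ A, C = .box A ∧ Ω.DelayedBox ∧ Derives F Ω P x A := by
  obtain ⟨hn, h⟩ := h
  cases h with
  | diaL => simp at hn
  | boxR _ _ A _ hd h => exact ⟨A, rfl, hd, h⟩

theorem HasType.when_left {Q : Proc S F.arity V} (h : HasType F Ω (.when x Q) z C)
    (hz : x ≠ z) : ∃ A, ∃ Ω₁ : Ctx S V, Ω = (x, .dia A) ::ₘ Ω₁ ∧ Ω₁.DelayedBox ∧ C.DelayedDia ∧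
      Derives F ((x, A) ::ₘ Ω₁) Q z C := by
  obtain ⟨hn, h⟩ := h
  cases h with
  | diaL Ω₁ _ A _ _ _ hd h hC => exact ⟨A, Ω₁, rfl, hd, hC, h⟩
  | boxR => exact absurd rfl hz

end Inversion

/-! ### Messages as processes -/

section Messages

variable {TName Label PName Chan : Type} {S : TypeDefs TName Label}

theorem Msg.toProc_rename (arity : PName → ℕ) (M : Msg Label Chan) (r : Chan → Chan) :
    ((M.rename r).toProc arity : Proc S arity Chan) = (M.toProc arity).rename r := by
  cases M <;> rfl

/-- The channels of a well-typed message are declared in its sequent. -/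
theorem Msg.mem_dom_of_mem_free {F : ProcDefs S PName} {Ω : Ctx S Chan} {M : Msg Label Chan}
    {e : Chan} {C : Ty S} (h : Derives F Ω (M.toProc F.arity) e C) {v : Chan}
    (hv : v ∈ M.free) (hve : v ≠ e) : v ∈ Ω.dom := by
  -- Every message except `close` ends in a forward, which provides its first channel and declares
  -- its second one.
  have key : ∀ {x y : Chan} {Ω : Ctx S Chan} {C : Ty S}, Derives F Ω (.fwd x y) e C →
      e = x ∧ y ∈ Ω.dom := by
    intro x y Ω C h
    obtain ⟨h1, rfl⟩ := h.fwd_inv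
    exact ⟨h1, by simp⟩
  cases M with
  | close => cases h; exact absurd hv hve
  | _ =>
    simp only [Msg.free, Set.mem_insert_iff, Set.mem_singleton_iff] at hv
    cases h <;> rename_i h <;> have h := key h <;>
      grind [Ctx.dom_cons]

end Messages

/-! ### Linearised configurations and their surgery -/

section Configurations

variable {TName Label PName Chan : Type} {S : TypeDefs TName Label} {F : ProcDefs S PName}

/-- The time of an object. -/
def Obj.time {arity : PName → ℕ} : Obj S arity Chan → ℕ
  | .proc _ t _ => t
  | .msg _ t _ => t

/-- The process expression that an object executes. -/
def Obj.expr {arity : PName → ℕ} : Obj S arity Chan → Proc S arity Chan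
  | .proc _ _ P => P
  | .msg _ _ M => M.toProc arity

/-- `B` may be used as `◯ᵗ Bₜ`, for all declarations `x:B` of `U` and `x:Bₜ` of `Ωt`. -/
def Ctx.Delays (t : ℕ) (U Ωt : Ctx S Chan) : Prop :=
  Ctx.Lift (fun B Bt => B.WeakSub (.nextN t Bt)) U Ωt

/-- The object `o` uses precisely the channels `U` and provides a channel of type `A`. Shifts by
the time of the object and weak subtyping are combined. -/
def ObjTyped (F : ProcDefs S PName) (U : Ctx S Chan) (o : Obj S F.arity Chan) (A : Ty S) : Prop :=
  ∃ Ωt At, U.Delays o.time Ωt ∧ HasType F Ωt o.expr o.provides At ∧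
    (Ty.nextN o.time At).WeakSub A

/-- Together with `ObjTyped.configDerives` this makes `ObjTyped` equivalent to the object rules:
shifts turn into subtypings, which compose by transitivity. -/
theorem ObjTyped.of_shift {Ω' Ω Ωt : Ctx S Chan} {o : Obj S F.arity Chan} {A At A' : Ty S}
    (h1 : Ctx.Lift Ty.WeakSub Ω' Ω) (h2 : Ctx.Lift (Ty.ShiftL o.time) Ω Ωt)
    (h3 : Ty.ShiftR o.time A At) (h4 : HasType F Ωt o.expr o.provides At)
    (h5 : A.WeakSub A') : ObjTyped F Ω' o A' :=
  ⟨Ωt, At, h1.comp h2 fun _ _ _ h h' => h.trans h'.weakSub, h4, h3.weakSub.trans h5⟩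

theorem ObjTyped.configDerives {U : Ctx S Chan} {o : Obj S F.arity Chan} {A : Ty S}
    (h : ObjTyped F U o A) (Ω₀ : Ctx S Chan) :
    ConfigDerives F (Ω₀ + U) {o} ((o.provides, A) ::ₘ Ω₀) := by
  obtain ⟨Ωt, At, hU, h, hA⟩ := h
  -- The intermediate context of the rule is taken to be ○ᵗΩt, which shifts to Ωt without using
  -- persistence of □.
  have h1 : Ctx.Lift Ty.WeakSub U (Ωt.map fun p => (p.1, Ty.nextN o.time p.2)) :=
    Multiset.rel_map_right.2 hU
  have h2 : Ctx.Lift (Ty.ShiftL o.time) (Ωt.map fun p => (p.1, Ty.nextN o.time p.2)) Ωt :=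
    Multiset.rel_map_left.2
      (Multiset.rel_refl_of_refl_on fun _ _ => ⟨rfl, Ty.shiftL_nextN _ _⟩)
  cases o with
  | proc c t P => exact .proc _ _ _ _ _ _ _ _ _ _ h1 h2 (Ty.shiftR_nextN _ _) h hA
  | msg c t M => exact .msg _ _ _ _ _ _ _ _ _ _ h1 h2 (Ty.shiftR_nextN _ _) h hA

/-- Configuration typing with the objects added one at a time, providers before clients. -/
inductive ConfigSeq (F : ProcDefs S PName) :
    Ctx S Chan → Config S F.arity Chan → Ctx S Chan → Prop
  | nil (Ω : Ctx S Chan) : ConfigSeq F Ω 0 Ω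
  | cons (Ω₀ U Ω : Ctx S Chan) (o : Obj S F.arity Chan) (A : Ty S) (C : Config S F.arity Chan) :
      ObjTyped F U o A → ConfigSeq F ((o.provides, A) ::ₘ Ω₀) C Ω →
      ConfigSeq F (Ω₀ + U) (o ::ₘ C) Ω

theorem ConfigSeq.append {Ω₀ Ω₁ Ω₂ : Ctx S Chan} {C₁ C₂ : Config S F.arity Chan}
    (h₁ : ConfigSeq F Ω₀ C₁ Ω₁) (h₂ : ConfigSeq F Ω₁ C₂ Ω₂) : ConfigSeq F Ω₀ (C₁ + C₂) Ω₂ := by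
  induction h₁ with
  | nil => rwa [zero_add]
  | cons _ _ _ _ _ _ ho _ ih => rw [Multiset.cons_add]; exact .cons _ _ _ _ _ _ ho (ih h₂)

theorem configSeq_iff {Ω' Ω : Ctx S Chan} {C : Config S F.arity Chan} :
    ConfigSeq F Ω' C Ω ↔ ConfigDerives F Ω' C Ω := by
  constructor
  · intro h
    induction h with
    | nil => exact .empty _
    | cons _ _ _ _ _ _ ho _ ih =>
      rw [← Multiset.singleton_add]
      exact .compose _ _ _ _ _ (ho.configDerives _) ih
  · intro h
    induction h with
    | empty => exact .nil _
    | compose _ _ _ _ _ _ _ ih₁ ih₂ => exact ih₁.append ih₂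
    | proc Ω₀ _ _ _ c t P _ _ _ h1 h2 h3 h4 h5 =>
      exact .cons _ _ _ _ _ 0 (.of_shift (o := .proc c t P) h1 h2 h3 h4 h5) (.nil _)
    | msg Ω₀ _ _ _ c t M _ _ _ h1 h2 h3 h4 h5 =>
      exact .cons _ _ _ _ _ 0 (.of_shift (o := .msg c t M) h1 h2 h3 h4 h5) (.nil _)

theorem ConfigSeq.frame {Ω' Ω : Ctx S Chan} {C : Config S F.arity Chan}
    (h : ConfigSeq F Ω' C Ω) (X : Ctx S Chan) : ConfigSeq F (X + Ω') C (X + Ω) := by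
  induction h with
  | nil => exact .nil _
  | cons Ω₀ U Ω o A C ho _ ih =>
    rw [← add_assoc]
    exact .cons _ _ _ _ _ _ ho (by rwa [← Multiset.add_cons])

/-- The bound is one of multisets, so distinctness of all channels at the start passes to every
intermediate context. -/
theorem ConfigSeq.dom_le {Ω' Ω : Ctx S Chan} {C : Config S F.arity Chan}
    (h : ConfigSeq F Ω' C Ω) : Ω.dom ≤ Ω'.dom + C.map Obj.provides := by
  induction h with
  | nil => simp
  | cons Ω₀ U Ω o A C ho _ ih =>
    refine ih.trans ?_
    rw [Ctx.dom_cons, Ctx.dom_add, Multiset.map_cons, Multiset.cons_add, Multiset.add_cons,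
      add_right_comm]
    exact Multiset.cons_le_cons _ (Multiset.le_add_right _ _)

/-- Objects that replace `o`, using the same channels and providing the same channel, may do so
inside a configuration. -/
theorem ConfigSeq.replace {Ω' Ω : Ctx S Chan} {o : Obj S F.arity Chan}
    {rest rhs : Config S F.arity Chan} {N : Set Chan} (h : ConfigSeq F Ω' (o ::ₘ rest) Ω)
    (hΩ : ∀ v ∈ Ω'.dom, v ∈ N) (hN : ∀ o' ∈ o ::ₘ rest, o'.provides ∈ N)
    (H : ∀ U A, (∀ v ∈ U.dom, v ∈ N) → ObjTyped F U o A →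
      ConfigSeq F U rhs {(o.provides, A)}) :
    ConfigSeq F Ω' (rhs + rest) Ω := by
  generalize hC : o ::ₘ rest = C at h
  induction h generalizing rest with
  | nil => exact absurd hC (Multiset.cons_ne_zero)
  | cons Ω₀ U Ω o₁ A C ho hs ih =>
    rcases Multiset.cons_eq_cons.1 hC with ⟨rfl, rfl⟩ | ⟨-, C', rfl, rfl⟩
    · refine ((H U A (fun v hv => hΩ v (by simp [hv])) ho).frame Ω₀).append ?_
      rwa [add_comm, Multiset.singleton_add]
    · rw [Multiset.add_cons]
      -- Each step adds to the context only a channel provided in the configuration, so `N` still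
      -- contains all declared channels.
      refine .cons _ _ _ _ _ _ ho (ih ?_ (fun o' ho' => hN o' ?_) rfl)
      · intro v hv
        rw [Ctx.dom_cons, Multiset.mem_cons] at hv
        rcases hv with rfl | hv
        · exact hN _ (by simp)
        · exact hΩ _ (by simp [hv])
      · rw [Multiset.cons_swap]
        exact Multiset.mem_cons_of_mem ho'

/-- A channel used by `o` must be present from the start or be provided by an earlier object. This
refutes a second client of a linear channel. -/
theorem ConfigSeq.mem_of_client {Ω' Ω : Ctx S Chan} {c : Chan} {o : Obj S F.arity Chan}
    {rest : Config S F.arity Chan} (h : ConfigSeq F Ω' (o ::ₘ rest) Ω)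
    (hc : ∀ U A, ObjTyped F U o A → c ∈ U.dom) :
    c ∈ Ω'.dom + (o ::ₘ rest).map Obj.provides := by
  generalize hC : o ::ₘ rest = C at h
  induction h generalizing rest with
  | nil => exact absurd hC (Multiset.cons_ne_zero)
  | cons Ω₂ U Ω o₁ B C ho hs ih =>
    rcases Multiset.cons_eq_cons.1 hC with ⟨rfl, rfl⟩ | ⟨-, C', rfl, rfl⟩
    · simp [hc _ _ ho]
    · have := ih rfl
      simp only [Ctx.dom_cons, Ctx.dom_add, Multiset.map_cons, Multiset.cons_add,
        Multiset.add_cons, Multiset.mem_cons, Multiset.mem_add] at this ⊢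
      tauto

/-- The client `o` of the channel `c` is brought forward to the point where `c` is available. -/
theorem ConfigSeq.split_client {Ω₀ Ω : Ctx S Chan} {c : Chan} {A : Ty S}
    {o : Obj S F.arity Chan} {rest : Config S F.arity Chan}
    (h : ConfigSeq F ((c, A) ::ₘ Ω₀) (o ::ₘ rest) Ω)
    (hn : (c ::ₘ Ω₀.dom + (o ::ₘ rest).map Obj.provides).Nodup)
    (hc : ∀ U A, ObjTyped F U o A → c ∈ U.dom) :
    ∃ R₁ R₂ Ω₁ U B, rest = R₁ + R₂ ∧ ConfigSeq F Ω₀ R₁ (Ω₁ + U) ∧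
      ObjTyped F ((c, A) ::ₘ U) o B ∧ ConfigSeq F ((o.provides, B) ::ₘ Ω₁) R₂ Ω := by
  generalize hC : o ::ₘ rest = C at h
  generalize hΩ' : (c, A) ::ₘ Ω₀ = Ω' at h
  induction h generalizing Ω₀ rest with
  | nil => exact absurd hC (Multiset.cons_ne_zero)
  | cons Ω₂ U Ω o₁ B C ho hs ih =>
    have hcΩ₀ : c ∉ Ω₀.dom := by
      rw [Multiset.cons_add, Multiset.nodup_cons] at hn
      exact fun h => hn.1 (Multiset.mem_add.2 (.inl h))
    have hmem : (c, A) ∈ Ω₂ + U := hΩ' ▸ Multiset.mem_cons_self _ _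
    rcases Multiset.cons_eq_cons.1 hC with ⟨rfl, rfl⟩ | ⟨-, C', rfl, rfl⟩
    -- Here `o` comes next. It uses `c`, and the only declaration of `c` has type `A`, so that
    -- declaration goes to `o`.
    · have hcU : (c, A) ∈ U := by
        obtain ⟨A', hA'⟩ := Ctx.mem_dom.1 (hc _ _ ho)
        have h2 : (c, A') ∈ (c, A) ::ₘ Ω₀ := hΩ' ▸ Multiset.mem_add.2 (.inr hA')
        rcases Multiset.mem_cons.1 h2 with h2 | h2
        · rwa [← h2]
        · exact absurd (Ctx.mem_dom.2 ⟨_, h2⟩) hcΩ₀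
      obtain ⟨U', rfl⟩ := Multiset.exists_cons_of_mem hcU
      rw [Multiset.add_cons, Multiset.cons_inj_right] at hΩ'
      exact ⟨0, _, Ω₂, U', B, (zero_add _).symm, hΩ' ▸ .nil _, ho, hs⟩
    · have hcΩ₂ : (c, A) ∈ Ω₂ := by
        refine (Multiset.mem_add.1 hmem).resolve_right fun hcU => ?_
        -- a client of `c` other than `o` leaves no `c` for `o`
        obtain ⟨U', rfl⟩ := Multiset.exists_cons_of_mem hcU
        rw [Multiset.add_cons, Multiset.cons_inj_right] at hΩ'
        subst hΩ'
        refine absurd (hs.mem_of_client hc) (by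
          simp only [Ctx.dom_cons, Ctx.dom_add, Multiset.map_cons, Multiset.cons_add,
            Multiset.add_cons, Multiset.nodup_cons, Multiset.mem_cons, Multiset.mem_add] at hn ⊢
          tauto)
      obtain ⟨Ω₃, rfl⟩ := Multiset.exists_cons_of_mem hcΩ₂
      rw [Multiset.cons_add, Multiset.cons_inj_right] at hΩ'
      subst hΩ'
      -- As `o₁` leaves `c` untouched, the channel it provides joins the ambient context and `c`
      -- stays in front.
      obtain ⟨R₁, R₂, Ω₁, U₁, B₁, rfl, h1, h2, h3⟩ := ih (Ω₀ := (o₁.provides, B) ::ₘ Ω₃)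
        (rest := C') (by
          refine Multiset.nodup_of_le ?_ hn
          refine le_of_le_of_eq (Multiset.le_add_right _ U.dom) ?_
          simp only [Ctx.dom_cons, Ctx.dom_add, Multiset.map_cons]
          simp only [← Multiset.singleton_add]
          abel) rfl (Multiset.cons_swap _ _ _)
      exact ⟨o₁ ::ₘ R₁, R₂, Ω₁, U₁, B₁, (Multiset.cons_add _ _ _).symm,
        .cons _ _ _ _ _ _ ho h1, h2, h3⟩

/-- A provider `o₁` and its client `o₂` may be replaced by a single object. -/
theorem ConfigSeq.merge {Ω' Ω : Ctx S Chan} {o₁ o₂ o : Obj S F.arity Chan}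
    {rest : Config S F.arity Chan} (h : ConfigSeq F Ω' (o₁ ::ₘ o₂ ::ₘ rest) Ω)
    (hn : (Ω'.dom + (o₁ ::ₘ o₂ ::ₘ rest).map Obj.provides).Nodup)
    (ho : o.provides = o₂.provides)
    (hc : ∀ U A, ObjTyped F U o₂ A → o₁.provides ∈ U.dom)
    (H : ∀ (U₁ U₂ : Ctx S Chan) (A₁ A₂ : Ty S),
      (o₁.provides ::ₘ o₂.provides ::ₘ (U₁.dom + U₂.dom)).Nodup →
      ObjTyped F U₁ o₁ A₁ → ObjTyped F ((o₁.provides, A₁) ::ₘ U₂) o₂ A₂ →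
      ObjTyped F (U₁ + U₂) o A₂) :
    ConfigSeq F Ω' (o ::ₘ rest) Ω := by
  generalize hC : o₁ ::ₘ o₂ ::ₘ rest = C at h
  induction h generalizing rest with
  | nil => exact absurd hC (Multiset.cons_ne_zero)
  | cons Ω₀ U Ω o₃ A C ho₃ hs ih =>
    rcases Multiset.cons_eq_cons.1 hC with ⟨rfl, rfl⟩ | ⟨-, C', hC', rfl⟩
    · obtain ⟨R₁, R₂, Ω₁, U₂, B, rfl, h1, h2, h3⟩ := hs.split_client (by
        refine Multiset.nodup_of_le ?_ hn
        rw [Multiset.map_cons _ o₁, Multiset.add_cons, Multiset.cons_add,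
          Multiset.cons_le_cons_iff, Ctx.dom_add, add_right_comm]
        exact Multiset.le_add_right _ _) hc
      have hU := H U U₂ A B (by
        refine Multiset.nodup_of_le ?_ hn
        -- The channels of `U₂` stem from `Ω₀` or from providers in `R₁`, hence differ from those of
        -- `U` and from the two provided channels.
        have h4 := h1.dom_le
        rw [Ctx.dom_add] at h4
        simp only [Ctx.dom_add, Multiset.map_cons, Multiset.add_cons, Multiset.map_add]
        rw [Multiset.cons_le_cons_iff, Multiset.cons_le_cons_iff]
        calc U.dom + U₂.dom ≤ U.dom + (Ω₁.dom + U₂.dom) := by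
              gcongr; exact Multiset.le_add_left _ _
          _ ≤ U.dom + (Ω₀.dom + R₁.map Obj.provides) := by gcongr
          _ ≤ U.dom + (Ω₀.dom + R₁.map Obj.provides) + R₂.map Obj.provides :=
              Multiset.le_add_right _ _
          _ = Ω₀.dom + U.dom + (R₁.map Obj.provides + R₂.map Obj.provides) := by abel) ho₃ h2
      -- The objects in `R₁` do not need `o₁`: they are typed first, while `U` is set aside for the
      -- merged object.
      have h5 := h1.frame U
      rw [add_comm U Ω₀] at h5
      rw [← Multiset.add_cons]
      refine h5.append ?_
      rw [add_left_comm]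
      exact .cons _ _ _ _ _ _ hU (ho ▸ h3)
    · rcases Multiset.cons_eq_cons.1 hC' with ⟨rfl, rfl⟩ | ⟨-, C'', rfl, rfl⟩
      -- A client placed before its provider would take the common channel from `Ω'`, so that
      -- channel would occur twice.
      · exfalso
        have h1 := hc _ _ ho₃
        simp only [Ctx.dom_add, Multiset.map_cons, Multiset.add_cons, Multiset.nodup_cons,
          Multiset.mem_cons, Multiset.mem_add] at hn
        tauto
      · rw [Multiset.cons_swap]
        refine .cons _ _ _ _ _ _ ho₃ (ih ?_ rfl)
        refine Multiset.nodup_of_le ?_ hn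
        refine le_of_le_of_eq (Multiset.le_add_right _ U.dom) ?_
        simp only [Ctx.dom_cons, Ctx.dom_add, Multiset.map_cons]
        simp only [← Multiset.singleton_add]
        abel

theorem ConfigTyped.relabel {Ω' Ω : Ctx S Chan} {o o' : Obj S F.arity Chan}
    {rest : Config S F.arity Chan} (h : ConfigTyped F Ω' ({o} + rest) Ω)
    (ho : o'.provides = o.provides) (H : ∀ U A, ObjTyped F U o A → ObjTyped F U o' A) :
    ConfigTyped F Ω' ({o'} + rest) Ω := by
  obtain ⟨hn, h⟩ := h
  refine ⟨by simpa [ho] using hn, ?_⟩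
  rw [← configSeq_iff] at h ⊢
  refine ConfigSeq.replace (N := Set.univ) h (fun _ _ => trivial) (fun _ _ => trivial)
    fun U A _ hU => ?_
  have := ConfigSeq.cons 0 U _ _ _ 0 (H U A hU) (.nil _)
  rwa [zero_add, ho] at this

theorem ConfigTyped.spawn {Ω' Ω : Ctx S Chan} {o o₁ o₂ : Obj S F.arity Chan}
    {rest : Config S F.arity Chan} (h : ConfigTyped F Ω' ({o} + rest) Ω)
    (ho : o₂.provides = o.provides)
    (hf : o₁.provides ∉ {c | c ∈ Ω'.dom} ∪ {v | ∃ o' ∈ {o} + rest, v ∈ o'.channels})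
    (H : ∀ U A, o₁.provides ∉ U.dom → o₁.provides ≠ o.provides → ObjTyped F U o A →
      ∃ U₁ U₂ B, U = U₁ + U₂ ∧ ObjTyped F U₁ o₁ B ∧
        ObjTyped F ((o₁.provides, B) ::ₘ U₂) o₂ A) :
    ConfigTyped F Ω' ({o₁, o₂} + rest) Ω := by
  have hch : ∀ o' : Obj S F.arity Chan, o'.provides ∈ o'.channels := by
    rintro (_ | _) <;> exact .inl rfl
  have hf1 : o₁.provides ∉ Ω'.dom := fun h => hf (.inl h)
  have hf2 : ∀ o' ∈ {o} + rest, o'.provides ≠ o₁.provides :=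
    fun o' h' e => hf (.inr ⟨o', h', e ▸ hch o'⟩)
  obtain ⟨hn, h⟩ := h
  constructor
  · rw [Multiset.insert_eq_cons, Multiset.cons_add, Multiset.map_cons, Multiset.add_cons,
      Multiset.nodup_cons]
    refine ⟨?_, by simpa [ho] using hn⟩
    rw [Multiset.mem_add, Multiset.mem_map]
    rintro (h' | ⟨o', h', he⟩)
    · exact hf1 h'
    · rw [Multiset.singleton_add, Multiset.mem_cons] at h'
      rcases h' with rfl | h'
      · exact hf2 o (by simp) (ho.symm.trans he)
      · exact hf2 o' (by simp [h']) he
  rw [← configSeq_iff] at h ⊢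
  -- Choosing `N` as everything except the fresh channel shows that the channels used by `o` avoid
  -- it.
  refine ConfigSeq.replace (N := {v | v ≠ o₁.provides}) h (fun v hv e => hf1 (e ▸ hv)) hf2
    fun U A hU hA => ?_
  obtain ⟨U₁, U₂, B, rfl, h1, h2⟩ := H U A (fun h' => hU _ h' rfl)
    (fun e => hf2 o (by simp) e.symm) hA
  rw [add_comm U₁, Multiset.insert_eq_cons]
  refine .cons _ _ _ _ _ _ h1 ?_
  have := ConfigSeq.cons 0 _ _ _ _ 0 h2 (.nil _)
  rwa [zero_add, ho] at this

theorem ConfigTyped.merge {Ω' Ω : Ctx S Chan} {o₁ o₂ o : Obj S F.arity Chan}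
    {rest : Config S F.arity Chan} (h : ConfigTyped F Ω' ({o₁, o₂} + rest) Ω)
    (ho : o.provides = o₂.provides)
    (hc : ∀ U A, o₁.provides ≠ o₂.provides → ObjTyped F U o₂ A → o₁.provides ∈ U.dom)
    (H : ∀ (U₁ U₂ : Ctx S Chan) (A₁ A₂ : Ty S),
      (o₁.provides ::ₘ o₂.provides ::ₘ (U₁.dom + U₂.dom)).Nodup →
      ObjTyped F U₁ o₁ A₁ → ObjTyped F ((o₁.provides, A₁) ::ₘ U₂) o₂ A₂ →
      ObjTyped F (U₁ + U₂) o A₂) :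
    ConfigTyped F Ω' ({o} + rest) Ω := by
  obtain ⟨hn, h⟩ := h
  have hne : o₁.provides ≠ o₂.provides := by
    intro e
    simp [e] at hn
  rw [Multiset.insert_eq_cons, Multiset.cons_add, Multiset.singleton_add] at hn h
  constructor
  · refine Multiset.nodup_of_le ?_ hn
    rw [Multiset.singleton_add, Multiset.map_cons, Multiset.map_cons, Multiset.map_cons, ho]
    gcongr
    exact Multiset.le_cons_self _ _
  rw [← configSeq_iff] at h ⊢
  exact h.merge hn ho (fun U A => hc U A hne) H

end Configurations

/-! ### Preservation of typing for the objects taking part in a step -/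

section Dynamics

variable {TName Label PName Chan : Type} {S : TypeDefs TName Label} {F : ProcDefs S PName}
  {U U₁ U₂ : Ctx S Chan} {A A₁ A₂ : Ty S} {c c' d e : Chan} {s t : ℕ}

theorem objTyped_proc {P : Proc S F.arity Chan} : ObjTyped F U (.proc c t P) A ↔
    ∃ Ωt At, U.Delays t Ωt ∧ HasType F Ωt P c At ∧ (Ty.nextN t At).WeakSub A := Iff.rfl

theorem objTyped_msg {M : Msg Label Chan} : ObjTyped F U (.msg c t M) A ↔
    ∃ Ωt At, U.Delays t Ωt ∧ HasType F Ωt (M.toProc F.arity) c At ∧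
      (Ty.nextN t At).WeakSub A := Iff.rfl

theorem Ctx.Delays.mem_dom_iff {Ω : Ctx S Chan} (h : U.Delays t Ω) {v : Chan} :
    v ∈ U.dom ↔ v ∈ Ω.dom := by
  rw [h.dom_eq]

/-! ### Spawning -/

theorem ObjTyped.cut {B : Ty S} {P Q : Proc S F.arity (Option Chan)}
    (h : ObjTyped F U (.proc c t (.cut B P Q)) A) {a : Chan} (ha : a ∉ U.dom) (hac : a ≠ c) :
    ∃ U₁ U₂ B, U = U₁ + U₂ ∧ ObjTyped F U₁ (.proc a t (P.rename (inst a))) B ∧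
      ObjTyped F ((a, B) ::ₘ U₂) (.proc c t (Q.rename (inst a))) A := by
  obtain ⟨Ωt, At, hU, hP, hA⟩ := objTyped_proc.1 h
  obtain ⟨Ω₁, Ω₂, rfl, h1, h2⟩ := hP.2.cut_inv
  have hn := hP.1
  obtain ⟨U₁, U₂, hU₁, hU₂, rfl⟩ := Ctx.Lift.add_right hU
  have hd₁ : U₁.dom = Ω₁.dom := hU₁.dom_eq
  have hd₂ : U₂.dom = Ω₂.dom := hU₂.dom_eq
  rw [Ctx.dom_add, hd₁, hd₂, Multiset.mem_add, not_or] at ha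
  rw [Ctx.dom_add, Multiset.nodup_cons, Multiset.nodup_add, Multiset.mem_add, not_or] at hn
  -- The new channel has type ○ᵗB, so both ends meet it by reflexivity. `U₂` is listed first because
  -- `P` owns the second half of the split.
  refine ⟨U₂, U₁, .nextN t B, add_comm _ _, ⟨Ω₂, B, hU₂, ⟨?_, h1.inst_right a⟩, .refl _⟩,
    ⟨(a, B) ::ₘ Ω₁, At, .cons (.refl _) hU₁, ⟨?_, h2.inst_left a⟩, hA⟩⟩
  · exact Multiset.nodup_cons.2 ⟨ha.2, hn.2.2.1⟩
  · simp [Obj.provides, hac.symm, hn, ha]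

theorem ObjTyped.call (hF : F.WellTyped) {f : PName} {es : Fin (F.arity f) → Chan}
    {Q : Proc S F.arity (Option Chan)} (h : ObjTyped F U (.proc c t (.call f es Q)) A)
    {a : Chan} (ha : a ∉ U.dom) (hac : a ≠ c) :
    ∃ U₁ U₂ B, U = U₁ + U₂ ∧
      ObjTyped F U₁ (.proc a t ((F.body f).rename (instBody a es))) B ∧
      ObjTyped F ((a, B) ::ₘ U₂) (.proc c t (Q.rename (inst a))) A := by
  obtain ⟨Ωt, At, hU, hP, hA⟩ := objTyped_proc.1 h
  obtain ⟨Ω₁, rfl, h2⟩ := hP.2.call_inv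
  have hn := hP.1
  obtain ⟨U₁, U₂, hU₁, hU₂, rfl⟩ := Ctx.Lift.add_right hU
  have hd₁ : U₁.dom = Ω₁.dom := hU₁.dom_eq
  have hd₂ : U₂.dom = (Ctx.ofFn es (F.params f)).dom := hU₂.dom_eq
  rw [Ctx.dom_add, hd₁, hd₂, Multiset.mem_add, not_or] at ha
  rw [Ctx.dom_add, Multiset.nodup_cons, Multiset.nodup_add, Multiset.mem_add, not_or] at hn
  refine ⟨U₂, U₁, .nextN t (F.result f), add_comm _ _,
    ⟨_, _, hU₂, ⟨?_, (hF f).2.instBody a es⟩, .refl _⟩,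
    ⟨(a, F.result f) ::ₘ Ω₁, At, .cons (.refl _) hU₁, ⟨?_, h2.inst_left a⟩, hA⟩⟩
  -- The actual arguments are distinct because the sequent of the caller is; the definition only
  -- supplies the derivation to be renamed.
  · exact Multiset.nodup_cons.2 ⟨ha.2, hn.2.2.1⟩
  · simp [Obj.provides, hac.symm, hn, ha]

/-! ### Passing of time -/

/-- A unit left shift gives Ωt <: ○Ω₁, hence U <: ○ᵗΩt <: ○ᵗ⁺¹Ω₁; the provided type is treated
dually. -/
theorem ObjTyped.delay {P : Proc S F.arity Chan} (h : ObjTyped F U (.proc c t (.delay P)) A) :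
    ObjTyped F U (.proc c (t + 1) P) A := by
  obtain ⟨Ωt, At, hU, hP, hA⟩ := objTyped_proc.1 h
  obtain ⟨Ω₁, B, hΩ, hB, hD⟩ := hP.2.delay_inv
  exact objTyped_proc.2 ⟨Ω₁, B,
    Ctx.Lift.comp hU hΩ fun _ _ _ h h' => h.trans (h'.weakSub_nextN t),
    ⟨by rw [← hΩ.dom_eq]; exact hP.1, hD⟩, (hB.weakSub_nextN t).trans hA⟩

theorem Ctx.Delays.mono_of_delayedBox {Ω : Ctx S Chan} (h : U.Delays s Ω) (hΩ : Ω.DelayedBox)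
    (hst : s ≤ t) : U.Delays t Ω :=
  Multiset.Rel.mono h fun _ _ q hq hpq => ⟨hpq.1, hpq.2.trans ((hΩ q hq).weakSub_nextN hst)⟩

theorem ObjTyped.wait_of_close {Q : Proc S F.arity Chan}
    (h₁ : ObjTyped F U₁ (.msg c t (.close c)) A₁)
    (h₂ : ObjTyped F ((c, A₁) ::ₘ U₂) (.proc d t (.wait c Q)) A₂) :
    ObjTyped F (U₁ + U₂) (.proc d t Q) A₂ := by
  obtain ⟨Ω₁, B₁, hU₁, hP₁, hA₁⟩ := objTyped_msg.1 h₁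
  obtain ⟨Ω₂, B₂, hU₂, hP₂, hA₂⟩ := objTyped_proc.1 h₂
  obtain ⟨-, rfl, rfl⟩ := hP₁.2.close_inv
  obtain rfl := Multiset.rel_zero_right.1 hU₁
  obtain ⟨Ω, rfl, hQ⟩ := hP₂.2.wait_inv
  have hn₂ := hP₂.1
  simp only [Ctx.dom_cons, Multiset.nodup_cons, Multiset.mem_cons, not_or] at hn₂
  obtain ⟨-, hU⟩ := Ctx.Lift.cons_cons hU₂ hn₂.2.1
  rw [zero_add]
  exact objTyped_proc.2 ⟨Ω, B₂, hU, ⟨Multiset.nodup_cons.2 ⟨hn₂.1.2, hn₂.2.2⟩, hQ⟩, hA₂⟩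

variable [DecidableEq Chan]

/-! ### Sending -/

theorem ObjTyped.sel_right {k : Label} {P : Proc S F.arity Chan}
    (h : ObjTyped F U (.proc c t (.sel c k P)) A) (hc' : c' ∉ U.dom) (hne : c' ≠ c) :
    ∃ U₁ U₂ B, U = U₁ + U₂ ∧ ObjTyped F U₁ (.proc c' t (P.rename (subst c' c))) B ∧
      ObjTyped F ((c', B) ::ₘ U₂) (.msg c t (.selR c k c')) A := by
  obtain ⟨Ωt, At, hU, hP, hA⟩ := objTyped_proc.1 h
  obtain ⟨L, B, hk, rfl, hD⟩ := hP.sel_right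
  rw [hU.mem_dom_iff] at hc'
  -- The continuation keeps all used channels; the message uses only the fresh `c'`.
  exact ⟨U, 0, .nextN t (B ⟨k, hk⟩), (add_zero _).symm,
    ⟨Ωt, _, hU, ⟨Multiset.nodup_cons.2 ⟨hc', hP.nodup_dom⟩, hD.subst_right hP.notMem_dom c'⟩,
      .refl _⟩,
    ⟨{(c', B ⟨k, hk⟩)}, _, .singleton (.refl _),
      ⟨by simp [Obj.provides, hne.symm], .plusR _ _ _ _ ⟨k, hk⟩ _ (.id _ _ _)⟩, hA⟩⟩

theorem ObjTyped.now_right {P : Proc S F.arity Chan}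
    (h : ObjTyped F U (.proc c t (.now c P)) A) (hc' : c' ∉ U.dom) (hne : c' ≠ c) :
    ∃ U₁ U₂ B, U = U₁ + U₂ ∧ ObjTyped F U₁ (.proc c' t (P.rename (subst c' c))) B ∧
      ObjTyped F ((c', B) ::ₘ U₂) (.msg c t (.nowR c c')) A := by
  obtain ⟨Ωt, At, hU, hP, hA⟩ := objTyped_proc.1 h
  obtain ⟨B, rfl, hD⟩ := hP.now_right
  rw [hU.mem_dom_iff] at hc'
  exact ⟨U, 0, .nextN t B, (add_zero _).symm,
    ⟨Ωt, _, hU, ⟨Multiset.nodup_cons.2 ⟨hc', hP.nodup_dom⟩, hD.subst_right hP.notMem_dom c'⟩,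
      .refl _⟩,
    ⟨{(c', B)}, _, .singleton (.refl _),
      ⟨by simp [Obj.provides, hne.symm], .diaR _ _ _ _ (.id _ _ _)⟩, hA⟩⟩

/-- The declaration of `d` passes from the sender to the message, with its subtyping. -/
theorem ObjTyped.send_right {P : Proc S F.arity Chan}
    (h : ObjTyped F U (.proc c t (.send c d P)) A) (hc' : c' ∉ U.dom) (hne : c' ≠ c) :
    ∃ U₁ U₂ B, U = U₁ + U₂ ∧ ObjTyped F U₁ (.proc c' t (P.rename (subst c' c))) B ∧
      ObjTyped F ((c', B) ::ₘ U₂) (.msg c t (.sendR c d c')) A := by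
  obtain ⟨Ωt, At, hU, hP, hA⟩ := objTyped_proc.1 h
  rw [hU.mem_dom_iff] at hc'
  obtain ⟨B, B', Ω, rfl, rfl, hD⟩ := hP.send_right
  have hn := hP.1
  obtain ⟨D, U', hD', hU', rfl⟩ := Ctx.Lift.cons_right hU
  simp only [Ctx.dom_cons, Multiset.nodup_cons, Multiset.mem_cons, not_or] at hn hc'
  refine ⟨U', {(d, D)}, .nextN t B', ?_,
    ⟨Ω, _, hU', ⟨Multiset.nodup_cons.2 ⟨hc'.2, hn.2.2⟩, hD.subst_right hn.1.2 c'⟩, .refl _⟩,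
    ⟨(d, B) ::ₘ {(c', B')}, _, ?_,
      ⟨?_, .tensorR _ _ _ _ _ _ (.id _ _ _)⟩, hA⟩⟩
  · rw [add_comm, Multiset.singleton_add]
  · rw [← Multiset.insert_eq_cons, Multiset.pair_comm]
    exact .cons hD' (.singleton (.refl _))
  · simp [Obj.provides, hne.symm, hn, Ne.symm hc'.1]

/-- The message becomes the client of `c`, and the sender continues as client of the message along
`c'`. -/
theorem ObjTyped.sel_left {k : Label} {Q : Proc S F.arity Chan}
    (h : ObjTyped F U (.proc d t (.sel c k Q)) A) (hcd : c ≠ d) (hc' : c' ∉ U.dom)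
    (hne : c' ≠ d) :
    ∃ U₁ U₂ B, U = U₁ + U₂ ∧ ObjTyped F U₁ (.msg c' t (.selL c k c')) B ∧
      ObjTyped F ((c', B) ::ₘ U₂) (.proc d t (Q.rename (subst c' c))) A := by
  obtain ⟨Ωt, At, hU, hP, hA⟩ := objTyped_proc.1 h
  rw [hU.mem_dom_iff] at hc'
  obtain ⟨L, B, Ω, hk, rfl, hD⟩ := hP.sel_left hcd
  have hn := hP.1
  obtain ⟨D, U', hD', hU', rfl⟩ := Ctx.Lift.cons_right hU
  simp only [Ctx.dom_cons, Multiset.nodup_cons, Multiset.mem_cons, not_or] at hn hc'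
  exact ⟨{(c, D)}, U', .nextN t (B ⟨k, hk⟩), (Multiset.singleton_add _ _).symm,
    objTyped_msg.2 ⟨{(c, .amp L B)}, _, .singleton hD',
      ⟨by simp [hc'], .ampL 0 _ _ _ ⟨k, hk⟩ _ _ _ (.id _ _ _)⟩, .refl _⟩,
    ⟨(c', B ⟨k, hk⟩) ::ₘ Ω, _, .cons (.refl _) hU',
      ⟨by simp [Obj.provides, hc', hn, hne.symm], hD.subst_left hn.2.1 hcd c'⟩, hA⟩⟩

theorem ObjTyped.now_left {Q : Proc S F.arity Chan}
    (h : ObjTyped F U (.proc d t (.now c Q)) A) (hcd : c ≠ d) (hc' : c' ∉ U.dom)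
    (hne : c' ≠ d) :
    ∃ U₁ U₂ B, U = U₁ + U₂ ∧ ObjTyped F U₁ (.msg c' t (.nowL c c')) B ∧
      ObjTyped F ((c', B) ::ₘ U₂) (.proc d t (Q.rename (subst c' c))) A := by
  obtain ⟨Ωt, At, hU, hP, hA⟩ := objTyped_proc.1 h
  rw [hU.mem_dom_iff] at hc'
  obtain ⟨B, Ω, rfl, hD⟩ := hP.now_left hcd
  have hn := hP.1
  obtain ⟨D, U', hD', hU', rfl⟩ := Ctx.Lift.cons_right hU
  simp only [Ctx.dom_cons, Multiset.nodup_cons, Multiset.mem_cons, not_or] at hn hc'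
  exact ⟨{(c, D)}, U', .nextN t B, (Multiset.singleton_add _ _).symm,
    objTyped_msg.2 ⟨{(c, .box B)}, _, .singleton hD',
      ⟨by simp [hc'], .boxL 0 _ _ _ _ _ (.id _ _ _)⟩, .refl _⟩,
    ⟨(c', B) ::ₘ Ω, _, .cons (.refl _) hU',
      ⟨by simp [Obj.provides, hc', hn, hne.symm], hD.subst_left hn.2.1 hcd c'⟩, hA⟩⟩

theorem ObjTyped.send_left {Q : Proc S F.arity Chan}
    (h : ObjTyped F U (.proc e t (.send c d Q)) A) (hce : c ≠ e) (hc' : c' ∉ U.dom)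
    (hne : c' ≠ e) :
    ∃ U₁ U₂ B, U = U₁ + U₂ ∧ ObjTyped F U₁ (.msg c' t (.sendL c d c')) B ∧
      ObjTyped F ((c', B) ::ₘ U₂) (.proc e t (Q.rename (subst c' c))) A := by
  obtain ⟨Ωt, At, hU, hP, hA⟩ := objTyped_proc.1 h
  rw [hU.mem_dom_iff] at hc'
  obtain ⟨B, B', Ω, rfl, hD⟩ := hP.send_left hce
  have hn := hP.1
  obtain ⟨D, _, hD', hU₀, rfl⟩ := Ctx.Lift.cons_right hU
  obtain ⟨D', U', hD'', hU', rfl⟩ := hU₀.cons_right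
  simp only [Ctx.dom_cons, Multiset.nodup_cons, Multiset.mem_cons, not_or] at hn hc'
  exact ⟨(c, D) ::ₘ {(d, D')}, U', .nextN t B', by simp,
    objTyped_msg.2 ⟨(c, .lolli B B') ::ₘ {(d, B)}, _, .cons hD' (.singleton hD''),
      ⟨by simp [hc', hn], .lolliL 0 _ _ _ _ _ _ _ (.id _ _ _)⟩, .refl _⟩,
    ⟨(c', B') ::ₘ Ω, _, .cons (.refl _) hU',
      ⟨by simp [Obj.provides, hc', hn, hne.symm], hD.subst_left hn.2.1.2 hce c'⟩, hA⟩⟩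

/-! ### Forwarding -/

/-- The forward yields A₁ <: ○ˢB₂ <: A₂, so removing it leaves a subtyping in which its time `s` no
longer appears. -/
theorem ObjTyped.fwd_of_msg {M : Msg Label Chan}
    (hn : (d ::ₘ c ::ₘ (U₁.dom + U₂.dom)).Nodup) (h₁ : ObjTyped F U₁ (.msg d t M) A₁)
    (h₂ : ObjTyped F ((d, A₁) ::ₘ U₂) (.proc c s (.fwd c d)) A₂) :
    ObjTyped F (U₁ + U₂) (.msg c t (M.rename (subst c d))) A₂ := by
  obtain ⟨Ω₁, B₁, hU₁, hP₁, hA₁⟩ := objTyped_msg.1 h₁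
  obtain ⟨Ω₂, B₂, hU₂, hP₂, hA₂⟩ := objTyped_proc.1 h₂
  obtain ⟨-, rfl⟩ := hP₂.2.fwd_inv
  obtain ⟨hB, rfl⟩ := Ctx.Lift.cons_singleton hU₂
  simp only [Multiset.nodup_cons, Multiset.mem_cons, Multiset.mem_add, not_or,
    hU₁.mem_dom_iff] at hn
  rw [add_zero]
  refine objTyped_msg.2 ⟨Ω₁, B₁, hU₁, ⟨Multiset.nodup_cons.2 ⟨hn.2.1.1, hP₁.nodup_dom⟩, ?_⟩,
    (hA₁.trans hB).trans hA₂⟩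
  rw [Msg.toProc_rename]
  exact hP₁.2.subst_right hn.1.2.1 c

theorem ObjTyped.msg_of_fwd {M : Msg Label Chan}
    (hn : (c ::ₘ e ::ₘ (U₁.dom + U₂.dom)).Nodup)
    (h₁ : ObjTyped F U₁ (.proc c s (.fwd c d)) A₁)
    (h₂ : ObjTyped F ((c, A₁) ::ₘ U₂) (.msg e t M) A₂) :
    ObjTyped F (U₁ + U₂) (.msg e t (M.rename (subst d c))) A₂ := by
  obtain ⟨Ω₁, B₁, hU₁, hP₁, hA₁⟩ := objTyped_proc.1 h₁
  obtain ⟨Ω₂, B₂, hU₂, hP₂, hA₂⟩ := objTyped_msg.1 h₂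
  obtain ⟨-, rfl⟩ := hP₁.2.fwd_inv
  obtain ⟨D, hD, rfl⟩ := Ctx.Lift.singleton_right hU₁
  have hc : c ∈ Ω₂.dom := hU₂.mem_dom_iff.1 (by simp)
  obtain ⟨B, hB⟩ := Ctx.mem_dom.1 hc
  obtain ⟨Ω, rfl⟩ := Multiset.exists_cons_of_mem hB
  have hn₂ := hP₂.1
  simp only [Ctx.dom_cons, Multiset.nodup_cons, Multiset.mem_cons, not_or] at hn₂
  obtain ⟨hA, hU⟩ := Ctx.Lift.cons_cons hU₂ hn₂.2.1
  have hd := Ctx.Lift.dom_eq hU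
  simp only [Ctx.dom_singleton, Multiset.singleton_add, Multiset.nodup_cons, Multiset.mem_cons,
    not_or, hd] at hn ⊢
  -- The chain is D <: ○ˢB₁ <: A₁ <: ○ᵗB, through the type of the forward.
  refine objTyped_msg.2 ⟨(d, B) ::ₘ Ω, B₂, .cons ((hD.trans hA₁).trans hA) hU, ⟨?_, ?_⟩, hA₂⟩
  · simp [hn]
  · rw [Msg.toProc_rename]
    exact hP₂.2.subst_left hn₂.2.1 hn.1.1 d

/-! ### Receiving -/

theorem ObjTyped.case_left {L : Finset Label} {k : {l // l ∈ L}}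
    {Q : {l // l ∈ L} → Proc S F.arity Chan} (hn : (c ::ₘ d ::ₘ (U₁.dom + U₂.dom)).Nodup)
    (h₁ : ObjTyped F U₁ (.msg c t (.selR c k c')) A₁)
    (h₂ : ObjTyped F ((c, A₁) ::ₘ U₂) (.proc d t (.case c L Q)) A₂) :
    ObjTyped F (U₁ + U₂) (.proc d t ((Q k).rename (subst c' c))) A₂ := by
  obtain ⟨Ω₁, B₁, hU₁, hP₁, hA₁⟩ := objTyped_msg.1 h₁
  obtain ⟨Ω₂, B₂, hU₂, hP₂, hA₂⟩ := objTyped_proc.1 h₂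
  have hcd : c ≠ d := by simp at hn; tauto
  obtain ⟨L', B, hk, rfl, hD⟩ := hP₁.sel_right
  obtain ⟨-, rfl⟩ := hD.fwd_inv
  obtain ⟨D, hD, rfl⟩ := Ctx.Lift.singleton_right hU₁
  obtain ⟨B', Ω, rfl, hQ⟩ := hP₂.case_left hcd
  have hn₂ := hP₂.1
  simp only [Ctx.dom_cons, Multiset.nodup_cons, Multiset.mem_cons, not_or] at hn₂
  obtain ⟨hA, hU⟩ := Ctx.Lift.cons_cons hU₂ hn₂.2.1
  have hd := Ctx.Lift.dom_eq hU
  -- Both objects are at time `t`, so ○ᵗ cancels from the chained subtyping, and a ⊕ type is a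
  -- subtype only of itself.
  obtain ⟨rfl, hBB⟩ := Ty.plus_inj (hA₁.trans hA).of_nextN.plus_eq
  rw [hBB k hk k.2] at hD
  simp only [Ctx.dom_singleton, Multiset.singleton_add, Multiset.nodup_cons, Multiset.mem_cons,
    not_or, hd] at hn ⊢
  exact objTyped_proc.2 ⟨(c', B' k) ::ₘ Ω, B₂, .cons hD hU,
    ⟨by simp [hn], (hQ k).subst_left hn₂.2.1 hcd c'⟩, hA₂⟩

theorem ObjTyped.case_right {L : Finset Label} {k : {l // l ∈ L}}
    {P : {l // l ∈ L} → Proc S F.arity Chan} (hn : (c ::ₘ c' ::ₘ (U₁.dom + U₂.dom)).Nodup)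
    (h₁ : ObjTyped F U₁ (.proc c t (.case c L P)) A₁)
    (h₂ : ObjTyped F ((c, A₁) ::ₘ U₂) (.msg c' t (.selL c k c')) A₂) :
    ObjTyped F (U₁ + U₂) (.proc c' t ((P k).rename (subst c' c))) A₂ := by
  obtain ⟨Ω₁, B₁, hU₁, hP₁, hA₁⟩ := objTyped_proc.1 h₁
  obtain ⟨Ω₂, B₂, hU₂, hP₂, hA₂⟩ := objTyped_msg.1 h₂
  have hcc : c ≠ c' := by simp at hn; tauto
  obtain ⟨B, rfl, hP⟩ := hP₁.case_right
  obtain ⟨L', B', Ω, hk, rfl, hD⟩ := hP₂.sel_left hcc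
  obtain ⟨-, hΩ⟩ := hD.fwd_inv
  -- The forward inside the message has a one-element context, so the message uses `c` and nothing
  -- else.
  obtain ⟨h1, rfl⟩ := (Multiset.singleton_eq_cons_iff _).1 hΩ.symm
  obtain rfl := congrArg Prod.snd h1
  obtain ⟨hA, rfl⟩ := Ctx.Lift.cons_singleton hU₂
  obtain ⟨rfl, hBB⟩ := Ty.amp_inj (hA₁.trans hA).of_nextN.amp_eq
  simp only [Ctx.dom_zero, add_zero, Multiset.nodup_cons, Multiset.mem_cons, not_or,
    hU₁.mem_dom_iff] at hn ⊢
  refine objTyped_proc.2 ⟨Ω₁, _, hU₁, ⟨Multiset.nodup_cons.2 ⟨hn.2.1, hP₁.nodup_dom⟩,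
    (hP k).subst_right hn.1.2 c'⟩, ?_⟩
  rwa [hBB k k.2 hk]

theorem ObjTyped.recv_left {Q : Proc S F.arity (Option Chan)}
    (hn : (c ::ₘ e ::ₘ (U₁.dom + U₂.dom)).Nodup)
    (h₁ : ObjTyped F U₁ (.msg c t (.sendR c d c')) A₁)
    (h₂ : ObjTyped F ((c, A₁) ::ₘ U₂) (.proc e t (.recv c Q)) A₂) :
    ObjTyped F (U₁ + U₂) (.proc e t (Q.rename (substInst c' c d))) A₂ := by
  obtain ⟨Ω₁, B₁, hU₁, hP₁, hA₁⟩ := objTyped_msg.1 h₁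
  obtain ⟨Ω₂, B₂, hU₂, hP₂, hA₂⟩ := objTyped_proc.1 h₂
  have hce : c ≠ e := by simp at hn; tauto
  obtain ⟨B, B', Ω', rfl, rfl, hD⟩ := hP₁.send_right
  obtain ⟨-, rfl⟩ := hD.fwd_inv
  obtain ⟨D, U', hD, hU', rfl⟩ := Ctx.Lift.cons_right hU₁
  obtain ⟨D', hD', rfl⟩ := Ctx.Lift.singleton_right hU'
  obtain ⟨E, E', Ω, rfl, hQ⟩ := hP₂.recv_left hce
  have hn₂ := hP₂.1
  simp only [Ctx.dom_cons, Multiset.nodup_cons, Multiset.mem_cons, not_or] at hn₂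
  obtain ⟨hA, hU⟩ := Ctx.Lift.cons_cons hU₂ hn₂.2.1
  have hd := Ctx.Lift.dom_eq hU
  obtain ⟨rfl, rfl⟩ := Ty.tensor_inj (hA₁.trans hA).of_nextN.tensor_eq
  simp only [Ctx.dom_singleton, Ctx.dom_cons, Multiset.cons_add, Multiset.singleton_add,
    Multiset.nodup_cons, Multiset.mem_cons, not_or, hd] at hn ⊢
  exact objTyped_proc.2 ⟨(d, B) ::ₘ (c', B') ::ₘ Ω, B₂, .cons hD (.cons hD' hU),
    ⟨by simp [hn], hQ.substInst_left hn₂.2.1 hce c' d⟩, hA₂⟩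

theorem ObjTyped.recv_right {P : Proc S F.arity (Option Chan)}
    (hn : (c ::ₘ c' ::ₘ (U₁.dom + U₂.dom)).Nodup)
    (h₁ : ObjTyped F U₁ (.proc c t (.recv c P)) A₁)
    (h₂ : ObjTyped F ((c, A₁) ::ₘ U₂) (.msg c' t (.sendL c d c')) A₂) :
    ObjTyped F (U₁ + U₂) (.proc c' t (P.rename (substInst c' c d))) A₂ := by
  obtain ⟨Ω₁, B₁, hU₁, hP₁, hA₁⟩ := objTyped_proc.1 h₁
  obtain ⟨Ω₂, B₂, hU₂, hP₂, hA₂⟩ := objTyped_msg.1 h₂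
  have hcc : c ≠ c' := by simp at hn; tauto
  obtain ⟨B, B', rfl, hP⟩ := hP₁.recv_right
  obtain ⟨E, E', Ω, rfl, hD⟩ := hP₂.send_left hcc
  obtain ⟨-, hΩ⟩ := hD.fwd_inv
  obtain ⟨h1, rfl⟩ := (Multiset.singleton_eq_cons_iff _).1 hΩ.symm
  obtain rfl := congrArg Prod.snd h1
  have hn₂ := hP₂.1
  simp only [Ctx.dom_cons, Multiset.nodup_cons, Multiset.mem_cons, not_or] at hn₂
  obtain ⟨hA, hU⟩ := Ctx.Lift.cons_cons hU₂ (by simpa using hn₂.2.1)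
  obtain ⟨D, hD', rfl⟩ := Ctx.Lift.singleton_right hU
  obtain ⟨rfl, rfl⟩ := Ty.lolli_inj (hA₁.trans hA).of_nextN.lolli_eq
  rw [add_comm U₁, Multiset.singleton_add]
  have hd := Ctx.Lift.dom_eq hU₁
  rw [add_comm U₁.dom, Ctx.dom_singleton, Multiset.singleton_add, hd] at hn
  simp only [Multiset.nodup_cons, Multiset.mem_cons, not_or] at hn
  exact objTyped_proc.2 ⟨(d, B) ::ₘ Ω₁, _, .cons hD' hU₁,
    ⟨by simp [hn], hP.substInst_right hn.1.2.2 c' d⟩, hA₂⟩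

/-- The recipient jumps from `s` to `t`: the channels it keeps satisfy U₂ <: ○ˢΩ <: ○ᵗΩ by
delayedness under □, and ○ᵗB₂ <: ○ˢB₂ <: A₂ by delayedness under ◇. -/
theorem ObjTyped.when_left {Q : Proc S F.arity Chan} (hst : s ≤ t)
    (hn : (c ::ₘ d ::ₘ (U₁.dom + U₂.dom)).Nodup)
    (h₁ : ObjTyped F U₁ (.msg c t (.nowR c c')) A₁)
    (h₂ : ObjTyped F ((c, A₁) ::ₘ U₂) (.proc d s (.when c Q)) A₂) :
    ObjTyped F (U₁ + U₂) (.proc d t (Q.rename (subst c' c))) A₂ := by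
  obtain ⟨Ω₁, B₁, hU₁, hP₁, hA₁⟩ := objTyped_msg.1 h₁
  obtain ⟨Ω₂, B₂, hU₂, hP₂, hA₂⟩ := objTyped_proc.1 h₂
  have hcd : c ≠ d := by simp at hn; tauto
  obtain ⟨B, rfl, hD⟩ := hP₁.now_right
  obtain ⟨-, rfl⟩ := hD.fwd_inv
  obtain ⟨D, hD, rfl⟩ := Ctx.Lift.singleton_right hU₁
  obtain ⟨B', Ω, rfl, hbox, hdia, hQ⟩ := hP₂.when_left hcd
  have hn₂ := hP₂.1
  simp only [Ctx.dom_cons, Multiset.nodup_cons, Multiset.mem_cons, not_or] at hn₂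
  obtain ⟨hA, hU⟩ := Ctx.Lift.cons_cons hU₂ hn₂.2.1
  have hd := Ctx.Lift.dom_eq hU
  obtain rfl := (hA₁.trans hA).nextN_dia_inj
  simp only [Ctx.dom_singleton, Multiset.singleton_add, Multiset.nodup_cons, Multiset.mem_cons,
    not_or, hd] at hn ⊢
  exact objTyped_proc.2 ⟨(c', B) ::ₘ Ω, B₂,
    .cons hD (Ctx.Delays.mono_of_delayedBox hU hbox hst),
    ⟨by simp [hn], hQ.subst_left hn₂.2.1 hcd c'⟩, (hdia.weakSub_nextN hst).trans hA₂⟩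

/-- Only the used channels need the jump from `s` to `t`; the result provides the channel of the
message, which is already at time `t`. -/
theorem ObjTyped.when_right {P : Proc S F.arity Chan} (hst : s ≤ t)
    (hn : (c ::ₘ c' ::ₘ (U₁.dom + U₂.dom)).Nodup)
    (h₁ : ObjTyped F U₁ (.proc c s (.when c P)) A₁)
    (h₂ : ObjTyped F ((c, A₁) ::ₘ U₂) (.msg c' t (.nowL c c')) A₂) :
    ObjTyped F (U₁ + U₂) (.proc c' t (P.rename (subst c' c))) A₂ := by
  obtain ⟨Ω₁, B₁, hU₁, hP₁, hA₁⟩ := objTyped_proc.1 h₁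
  obtain ⟨Ω₂, B₂, hU₂, hP₂, hA₂⟩ := objTyped_msg.1 h₂
  have hcc : c ≠ c' := by simp at hn; tauto
  obtain ⟨B, rfl, hbox, hP⟩ := hP₁.when_right
  obtain ⟨B', Ω, rfl, hD⟩ := hP₂.now_left hcc
  obtain ⟨-, hΩ⟩ := hD.fwd_inv
  obtain ⟨h1, rfl⟩ := (Multiset.singleton_eq_cons_iff _).1 hΩ.symm
  obtain rfl := congrArg Prod.snd h1
  obtain ⟨hA, rfl⟩ := Ctx.Lift.cons_singleton hU₂
  obtain rfl := (hA₁.trans hA).nextN_box_inj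
  simp only [Ctx.dom_zero, add_zero, Multiset.nodup_cons, Multiset.mem_cons, not_or,
    hU₁.mem_dom_iff] at hn ⊢
  exact objTyped_proc.2 ⟨Ω₁, _, hU₁.mono_of_delayedBox hbox hst,
    ⟨Multiset.nodup_cons.2 ⟨hn.2.1, hP₁.nodup_dom⟩, hP.subst_right hn.1.2 c'⟩, hA₂⟩

end Dynamics

end TemporalSession

/-! ### Type preservation, by cases on the rewriting rule -/

open TemporalSession in
theorem mainTheorem1 {TName Label PName Chan : Type} [DecidableEq Chan]
    (S : TemporalSession.TypeDefs TName Label) (F : TemporalSession.ProcDefs S PName)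
    (hF : F.WellTyped)
    (Ω' Ω : TemporalSession.Ctx S Chan) (C D : TemporalSession.Config S F.arity Chan)
    (hC : TemporalSession.ConfigTyped F Ω' C Ω)
    (hStep : TemporalSession.Step F {c | c ∈ Ω'.dom} C D) :
    TemporalSession.ConfigTyped F Ω' D Ω := by
  obtain ⟨lhs, rhs, rest, rfl, rfl, hR⟩ := hStep
  cases hR with
  | cutC c a t A P Q ha => exact hC.spawn rfl ha fun U A h1 h2 h => h.cut h1 h2
  | defC c a t f es Q ha => exact hC.spawn rfl ha fun U A h1 h2 h => h.call hF h1 h2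
  | idPosC c d s t M hst =>
    refine hC.merge rfl (fun U A _ h => ?_) fun U₁ U₂ A₁ A₂ hn h₁ h₂ => h₁.fwd_of_msg hn h₂
    obtain ⟨Ω, B, hU, hP, -⟩ := objTyped_proc.1 h
    obtain ⟨-, rfl⟩ := hP.2.fwd_inv
    exact hU.mem_dom_iff.2 (by simp [Obj.provides])
  | idNegC c d e s t M hc hst =>
    refine hC.merge rfl (fun U A hne h => ?_) fun U₁ U₂ A₁ A₂ hn h₁ h₂ => h₁.msg_of_fwd hn h₂
    obtain ⟨Ω, B, hU, hP, -⟩ := objTyped_msg.1 h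
    -- The message mentions `c` but provides `e`, and the two differ as provided channels, so it
    -- must be a client of `c`.
    exact hU.mem_dom_iff.2 (Msg.mem_dom_of_mem_free hP.2 hc hne)
  | plusS c c' t k P hc' =>
    exact hC.spawn rfl hc' fun U A h1 h2 h => h.sel_right h1 h2
  | plusC c c' d t L k Q =>
    refine hC.merge rfl (fun U A hne h => ?_) fun U₁ U₂ A₁ A₂ hn h₁ h₂ => h₁.case_left hn h₂
    obtain ⟨Ω, B, hU, hP, -⟩ := objTyped_proc.1 h
    obtain ⟨_, _, rfl, -⟩ := hP.case_left hne
    exact hU.mem_dom_iff.2 (by simp [Obj.provides])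
  | ampS c c' d t k Q hcd hc' =>
    exact hC.spawn rfl hc' fun U A h1 h2 h => h.sel_left hcd h1 h2
  | ampC c c' t L k Q =>
    refine hC.merge rfl (fun U A hne h => ?_) fun U₁ U₂ A₁ A₂ hn h₁ h₂ => h₁.case_right hn h₂
    obtain ⟨Ω, B, hU, hP, -⟩ := objTyped_msg.1 h
    obtain ⟨_, _, _, _, rfl, -⟩ := hP.sel_left hne
    exact hU.mem_dom_iff.2 (by simp [Obj.provides])
  -- `ObjTyped` sees only time, expression and provided channel, which the process and the message
  -- share.
  | oneS c t => exact hC.relabel rfl fun U A h => h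
  | oneC c d t Q =>
    refine hC.merge rfl (fun U A hne h => ?_) fun U₁ U₂ A₁ A₂ _ h₁ h₂ => h₁.wait_of_close h₂
    obtain ⟨Ω, B, hU, hP, -⟩ := objTyped_proc.1 h
    obtain ⟨_, rfl, -⟩ := hP.2.wait_inv
    exact hU.mem_dom_iff.2 (by simp [Obj.provides])
  | tensorS c c' d t P hc' =>
    exact hC.spawn rfl hc' fun U A h1 h2 h => h.send_right h1 h2
  | tensorC c c' d e t Q =>
    refine hC.merge rfl (fun U A hne h => ?_) fun U₁ U₂ A₁ A₂ hn h₁ h₂ => h₁.recv_left hn h₂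
    obtain ⟨Ω, B, hU, hP, -⟩ := objTyped_proc.1 h
    obtain ⟨_, _, _, rfl, -⟩ := hP.recv_left hne
    exact hU.mem_dom_iff.2 (by simp [Obj.provides])
  | lolliS c c' d e t Q hce hc' =>
    exact hC.spawn rfl hc' fun U A h1 h2 h => h.send_left hce h1 h2
  | lolliC c c' d t P =>
    refine hC.merge rfl (fun U A hne h => ?_) fun U₁ U₂ A₁ A₂ hn h₁ h₂ => h₁.recv_right hn h₂
    obtain ⟨Ω, B, hU, hP, -⟩ := objTyped_msg.1 h
    obtain ⟨_, _, _, rfl, -⟩ := hP.send_left hne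
    exact hU.mem_dom_iff.2 (by simp [Obj.provides])
  | nextC c t P => exact hC.relabel rfl fun U A h => h.delay
  | diaS c c' t P hc' =>
    exact hC.spawn rfl hc' fun U A h1 h2 h => h.now_right h1 h2
  | diaC c c' d s t Q hst =>
    refine hC.merge rfl (fun U A hne h => ?_) fun U₁ U₂ A₁ A₂ hn h₁ h₂ => h₁.when_left hst hn h₂
    obtain ⟨Ω, B, hU, hP, -⟩ := objTyped_proc.1 h
    obtain ⟨_, _, rfl, -⟩ := hP.when_left hne
    exact hU.mem_dom_iff.2 (by simp [Obj.provides])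
  | boxS c c' d t Q hcd hc' =>
    exact hC.spawn rfl hc' fun U A h1 h2 h => h.now_left hcd h1 h2
  | boxC c c' s t P hst =>
    refine hC.merge rfl (fun U A hne h => ?_) fun U₁ U₂ A₁ A₂ hn h₁ h₂ => h₁.when_right hst hn h₂
    obtain ⟨Ω, B, hU, hP, -⟩ := objTyped_msg.1 h
    obtain ⟨_, _, rfl, -⟩ := hP.now_left hne
    exact hU.mem_dom_iff.2 (by simp [Obj.provides])
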